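/- **Model.** Let $(X,Y)\in[0,1]^d\times\mathbb R$ ($d\ge1$) have law $\rho$, with $E(Y|X)=f^*(X)$ and $\mathrm{Var}(Y|X)=g^*(X)\ge 0$; write $\|h\|_{\mathcal L_2}^2=E\,h(X)^2$, and $h_A=\max(-A,\min(A,h))$ for clipping. Let $(x_i,y_i)_{i\le n}$ be i.i.d. copies of $(X,Y)$, and let $X$ be a new independent covariate. Let $\mathcal F(L,\nu)$ be the class of fully connected ReLU networks $\mathbb R^d\to\mathbb R$ with $L$ hidden layers of width $\nu$. A "least squares fit" in a class is obtained by a fixed measurable rule that maps the sample to a minimiser of the sum of squares over the class (minimisers are assumed to exist almost surely for large $n$). **Procedure.** For every $n$ let $\{1,\dots,n\}=I_1\cup I_2\cup I_3\cup I_4$ be a partition with $|I_k|\asymp n/4$; let $1\le\widetilde B<B$ be integers, $A_n$ a clipping level with $P(|Y|\le A_n)=1$, and $\alpha=\alpha_n\in(0,1)$ with $1/n=O(\alpha_n)$ (automatic if $\alpha$ is fixed). 1. $\hat f$ is a least squares fit in $\mathcal F(L,\nu)$ to $(x_i,y_i)_{i\in I_1}$. 2. $\hat g$ is a least squares fit in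 $\mathcal F(L',\nu')$ to $(x_i,(y_i-\hat f_{A_n}(x_i))^2)_{i\in I_2}$. 3. Let $\epsilon'_i=(y_i-\hat f_{A_n}(x_i))/\sqrt{|\hat g_{A_n}(x_i)|}$, $i\in I_2$, let $\tilde\epsilon_i$ be their standardization (empirical mean $0$, variance $1$; a quotient with denominator $0$ is read as $0$), and $\hat F$ the empirical distribution of $\{\tilde\epsilon_i\}_{i\in I_2}$. For $j=1,\dots,B+\widetilde B$ put $\tilde y^{(j)}_i=\hat f_{A_n}(x_i)+\sqrt{|\hat g_{A_n}(x_i)|}\,\tilde\epsilon^{(j)}_i$, $i\in I_3$, with $\tilde\epsilon^{(j)}_i$ drawn independently from $\hat F$. Then $\hat f^{(j)}$ is a least squares fit to $(x_i,\tilde y_i^{(j)})_{i\in I_3}$ and $\hat g^{(j)}$ a least squares fit to $(x_i,(\tilde y_i^{(j)}-\hat f^{(j)}_{A_n}(x_i))^2)_{i\in I_3}$, with network classes and fitting rules that do not depend on $j$. 4. For a clipping level $A$, $a_1(\alpha)$ is the $(1-\alpha/(4\widetilde B))$-quantile of $\frac1{|I_4|}\sum_{i\in I_4}(y_i-\hat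 f^{(j)}_{A}(x_i))^2$, $j=1,\dots,B$. 5. With $a_0=\alpha/(100\log^s n)$ and $b(\alpha)=1/(100\log^s n)$, where $s>0$ is fixed, put $$a(\alpha)=\Big|a_1(\alpha)+A^2\sqrt{\tfrac{32[\log(8/\alpha)+\log\widetilde B]}{n}}+A\sqrt{\tfrac{8[\log(64/\alpha)+\log\widetilde B]}{n}}-\tfrac1{|I_4|}\sum_{i\in I_4}\hat g^{(B+1)}_{A}(x_i)+a_0\Big|,$$ $$\Delta_A(\alpha)=2\sqrt{a(\alpha)/(\alpha\widetilde B)}+b(\alpha).$$ **Statement.** There is an absolute constant $c_0>0$ with the following property. Suppose that, for some $q>0$, $B\alpha^2/\widetilde B\to\infty$, $B=O(n^q)$, $$n^{q+1}\,P\Big(\max\{\|g^*-\hat g^{(B+1)}_{A_n}\|_{\mathcal L_2}^2,\ \|f^*-\hat f^{(B+1)}_{A_n}\|_{\mathcal L_2}^2\}>\varepsilon_n\Big)\to0,$$ and $\varepsilon_n\le c_0\,\alpha^2/\log^{2s}n$ for large $n$. (a) *Coverage.* For all large enough $n$, $$P\Big(f^*(X)\in\Big[\tfrac1{\widetilde B}\sum_{j=B+1}^{B+\widetilde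 B}\hat f^{(j)}_{A_n}(X)\pm\Delta_{A_n}(\alpha)\Big]\Big)\ge1-\alpha .$$ (b) *Length.* Let $\mathcal P_1,\mathcal P_2\subset[1,\infty)\times\mathbb N$ be finite and non-empty, $l_1,l_2\ge1$, and assume that $f^*\in\mathcal H(l_1,\mathcal P_1)$ and $g^*\in\mathcal H(l_2,\mathcal P_2)$. Here $\mathcal H(1,\mathcal P)$ consists of the functions $a\mapsto m(a_{\pi(1)},\dots,a_{\pi(K)})$ and $\mathcal H(l,\mathcal P)$, $l>1$, of the functions $m(f_1,\dots,f_K)$ with $f_i\in\mathcal H(l-1,\mathcal P)$, where in each case $(p,K)\in\mathcal P$ and $m:\mathbb R^K\to\mathbb R$ is $(p,C)$-smooth (with $p=q_m+s_m$, $q_m\in\mathbb N$, $0<s_m\le1$: $m$ is $q_m$ times continuously differentiable and its partial derivatives of order $q_m$ are $s_m$-Hölder with constant $C$), has partial derivatives of order $\le q_m$ bounded by $c_2$, and is Lipschitz with constant $C_{\mathrm{Lip}}\ge1$. Let $\phi_n=\max_{(p,K)\in\mathcal P_1}n^{-2p/(2p+K)}$ and $\psi_n=\max_{(p,K)\in\mathcal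 P_2}n^{-2p/(2p+K)}$. There is a constant $\bar c>0$, depending only on $d,\mathcal P_1,\mathcal P_2,l_1,l_2,C,c_2,C_{\mathrm{Lip}}$, such that the following holds for all constants $c_3,c_4,c_3',c_4'\ge\bar c$. Let $(L,\nu)$ be $$\Big(\lceil c_3\log n\rceil,\ \lceil c_4\max_{\mathcal P_1}n^{K/(2(2p+K))}\rceil\Big)\quad\text{or}\quad\Big(\lceil c_3\max_{\mathcal P_1}n^{K/(2(2p+K))}\log n\rceil,\ \lceil c_4\rceil\Big),$$ let $(L',\nu')$ be chosen likewise with $\mathcal P_2,c_3',c_4'$, and use in step 3 the class $\mathcal F(L,\nu)$ for $\hat f^{(j)}$ and $\mathcal F(L',\nu')$ for $\hat g^{(j)}$. Let $\mathcal U_n,\mathcal A_n,\mathcal B_n$ satisfy $n^qP(\max_{i\le n}|y_i-f^*(x_i)|>\mathcal U_n)\to0$ and, for large $n$, with $\|\cdot\|_\infty$ the supremum over $[0,1]^d$, $\mathcal A_n\ge8\max\{\|f^*\|_\infty+\mathcal U_n,8\|f^*\|_\infty,8\sqrt{\phi_n}\}$, $\mathcal B_n\ge\max\{8\mathcal A_n\|g^*\|_\infty,8\mathcal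 A_n\sqrt{\psi_n},\mathcal U_n^2+\tfrac94\mathcal U_n\mathcal A_n+\tfrac{65}{32}\mathcal A_n^2\}$ and $A_n>\max\{\mathcal A_n,\mathcal B_n\}$. Assume that $\mathrm{support}(\hat F)\subset[-A_n',A_n']$ almost surely for large $n$ and that $A_n,A_n',\mathcal U_n$ are each $O(\mathrm{poly}(\log n))$. Then there are $\widetilde A_n=O(\mathrm{poly}(\log n))$ and a polynomial $\mathrm{poly}_3$ such that, with $\widetilde A_n$ instead of $A_n$ in steps 4-5, the coverage statement (a) (with $\Delta_{\widetilde A_n}(\alpha)$ as half-width) still holds for large $n$, and $$\Delta_{\widetilde A_n}(\alpha)\le o_P\Big(\mathrm{poly}_3(\log n)\Big[\frac{\phi_n^{1/4}+\psi_n^{1/4}}{\widetilde B^{1/2}\alpha^{1/2}}+\frac{\log^{1/4}(1/\alpha)}{\widetilde B^{1/2}\alpha^{1/2}n^{1/4}}+\frac{\phi_n^{1/2}}{\alpha}\Big]\Big)+\sqrt{\frac1{\widetilde B\log^sn}}+\frac1{\log^sn},$$ i.e. for every $\eta>0$ the probability that $\Delta_{\widetilde A_n}(\alpha)$ exceeds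 $\eta$ times the argument of $o_P$ plus the last two terms tends to $0$. -/

import Mathlib

open MeasureTheory ProbabilityTheory Filter Asymptotics
open scoped Topology

noncomputable section

namespace BootCI

/-! ### Dense ReLU networks and least squares -/

/-- One hidden layer: `v ↦ max 0 (W v + c)`, coordinatewise. -/
def reluLayer {a b : ℕ} (W : Fin b → Fin a → ℝ) (c : Fin b → ℝ) (v : Fin a → ℝ) : Fin b → ℝ :=
  fun i => max 0 (∑ j, W i j * v j + c i)

/-- `IsHiddenMap d ν k h`: the map `h` is computed by `k + 1` successive hidden layers of width `ν`
on inputs from `ℝ^d`. -/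
def IsHiddenMap (d ν : ℕ) : ℕ → ((Fin d → ℝ) → Fin ν → ℝ) → Prop
  | 0, h => ∃ (W : Fin ν → Fin d → ℝ) (c : Fin ν → ℝ), h = reluLayer W c
  | k + 1, h => ∃ g, IsHiddenMap d ν k g ∧
      ∃ (W : Fin ν → Fin ν → ℝ) (c : Fin ν → ℝ), h = fun x => reluLayer W c (g x)

/-- The class `𝓕(L, ν)` of fully connected ReLU networks on `ℝ^d` with `L` hidden layers, all of
width `ν` (empty if `L = 0`). -/
def reluNets (d L ν : ℕ) : Set ((Fin d → ℝ) → ℝ) :=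
  {f | ∃ (k : ℕ) (h : (Fin d → ℝ) → Fin ν → ℝ) (w : Fin ν → ℝ) (c : ℝ),
    L = k + 1 ∧ IsHiddenMap d ν k h ∧ f = fun x => ∑ i, w i * h x i + c}

/-- `f` minimises the sum of squares over the class `𝓕(L, ν)` for the sample `z`. -/
def IsLeastSquares {d : ℕ} {ι : Type*} [Fintype ι] (L ν : ℕ) (z : ι → (Fin d → ℝ) × ℝ)
    (f : (Fin d → ℝ) → ℝ) : Prop :=
  f ∈ reluNets d L ν ∧
    ∀ h ∈ reluNets d L ν, ∑ i, ((z i).2 - f (z i).1) ^ 2 ≤ ∑ i, ((z i).2 - h (z i).1) ^ 2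

/-- Clipping at level `A`. -/
def clip (A t : ℝ) : ℝ := max (-A) (min A t)

/-- The empirical `τ`-quantile of `N` numbers: the least `t` such that at least a fraction `τ` of
them is `≤ t`. -/
def empQuantile {N : ℕ} (v : Fin N → ℝ) (τ : ℝ) : ℝ :=
  sInf {t | τ * N ≤ ((Finset.univ.filter fun j => v j ≤ t).card : ℝ)}

/-! ### The regression model -/

/-- `ρ` is the law of `(X, Y)`, with `X ∈ [0,1]^d`, `E(Y | X) = f*(X)`, `Var(Y | X) = g*(X)`. -/
structure IsRegressionModel {d : ℕ} (ρ : Measure ((Fin d → ℝ) × ℝ))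
    (fstar gstar : (Fin d → ℝ) → ℝ) : Prop where
  measurable_f : Measurable fstar
  measurable_g : Measurable gstar
  cube : ∀ᵐ z ∂ρ, z.1 ∈ Set.Icc (0 : Fin d → ℝ) 1
  nonneg : ∀ x ∈ Set.Icc (0 : Fin d → ℝ) 1, 0 ≤ gstar x
  sq_integrable : MemLp (fun z : (Fin d → ℝ) × ℝ => z.2) 2 ρ
  mean : ρ[fun z => z.2 | MeasurableSpace.comap Prod.fst inferInstance] =ᵐ[ρ]
    fun z => fstar z.1
  var : ρ[fun z => (z.2 - fstar z.1) ^ 2 | MeasurableSpace.comap Prod.fst inferInstance] =ᵐ[ρ]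
    fun z => gstar z.1

/-- `‖f‖∞` on the covariate domain `[0,1]^d`. -/
def supNorm {d : ℕ} (f : (Fin d → ℝ) → ℝ) : ℝ :=
  ⨆ x : Set.Icc (0 : Fin d → ℝ) 1, |f x|

/-- `‖h‖²` in `𝓛₂(ℙ_X)`, where `ℙ_X` is the first marginal of `ρ`. -/
def l2sq {d : ℕ} (ρ : Measure ((Fin d → ℝ) × ℝ)) (h : (Fin d → ℝ) → ℝ) : ℝ :=
  ∫ x, h x ^ 2 ∂ρ.fst

/-! ### The bootstrap procedure at sample size `n` -/

/-- The block of indices with label `k`. -/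
abbrev Block {n : ℕ} (part : Fin n → Fin 4) (k : Fin 4) : Type := {i : Fin n // part i = k}

/-- The inputs of the procedure at sample size `n`. The labels `part i = 0, 1, 2, 3` encode the
partition `{1, …, n} = I₁ ∪ I₂ ∪ I₃ ∪ I₄`. The four `fit` maps are the (measurable) rules that
select a least squares network from a sample; that they do so is a hypothesis
(`BootConfig.FitsLeastSquares`). -/
structure BootConfig (d n : ℕ) where
  part : Fin n → Fin 4
  /-- the number `B` of bootstrap samples used for the quantile -/
  B : ℕ
  /-- the number `B̃` of bootstrap samples used for the centre -/
  Bt : ℕ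
  Bt_pos : 0 < Bt
  Bt_lt : Bt < B
  /-- the clipping level `A_n` -/
  A : ℝ
  L : ℕ
  ν : ℕ
  L' : ℕ
  ν' : ℕ
  Lboot : ℕ
  νboot : ℕ
  Lboot' : ℕ
  νboot' : ℕ
  fitF : (Block part 0 → (Fin d → ℝ) × ℝ) → (Fin d → ℝ) → ℝ
  fitG : (Block part 1 → (Fin d → ℝ) × ℝ) → (Fin d → ℝ) → ℝ
  fitFboot : (Block part 2 → (Fin d → ℝ) × ℝ) → (Fin d → ℝ) → ℝ
  fitGboot : (Block part 2 → (Fin d → ℝ) × ℝ) → (Fin d → ℝ) → ℝ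
  measurable_fitF : Measurable (Function.uncurry fitF)
  measurable_fitG : Measurable (Function.uncurry fitG)
  measurable_fitFboot : Measurable (Function.uncurry fitFboot)
  measurable_fitGboot : Measurable (Function.uncurry fitGboot)

/-- The sample space: the data `(x_i, y_i)`; for each bootstrap sample `j` the indices drawn from
`I₂`; and the new covariate `X`. -/
abbrev Outcome (d n N : ℕ) : Type :=
  (Fin n → (Fin d → ℝ) × ℝ) × (Fin N → Fin n → Fin n) × (Fin d → ℝ)

namespace BootConfig

variable {d n : ℕ} (c : BootConfig d n)

/-- The joint law: i.i.d. data from `ρ`, independent uniform draws of indices from `I₂`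
(that is, sampling from the empirical distribution `F̂` indexed by `I₂`), and an independent
covariate `X ∼ ℙ_X`. -/
def law (ρ : Measure ((Fin d → ℝ) × ℝ)) : Measure (Outcome d n (c.B + c.Bt)) :=
  (Measure.pi fun _ => ρ).prod
    ((Measure.pi fun _ => Measure.pi fun _ => uniformOn {i | c.part i = 1}).prod ρ.fst)

/-- `f̂`, fitted on `I₁`. -/
def fhat (z : Fin n → (Fin d → ℝ) × ℝ) : (Fin d → ℝ) → ℝ :=
  c.fitF fun i => z i

/-- `ε̂_i = y_i - f̂_A(x_i)`. -/
def resid (z : Fin n → (Fin d → ℝ) × ℝ) (i : Fin n) : ℝ :=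
  (z i).2 - clip c.A (c.fhat z (z i).1)

/-- The sample `(x_i, ε̂_i²)`, `i ∈ I₂`. -/
def residSample (z : Fin n → (Fin d → ℝ) × ℝ) (i : Block c.part 1) : (Fin d → ℝ) × ℝ :=
  ((z i).1, c.resid z i ^ 2)

/-- `ĝ`, fitted on `I₂`. -/
def ghat (z : Fin n → (Fin d → ℝ) × ℝ) : (Fin d → ℝ) → ℝ :=
  c.fitG (c.residSample z)

/-- `ε'_i = (y_i - f̂_A(x_i)) / √|ĝ_A(x_i)|`. -/
def scaledResid (z : Fin n → (Fin d → ℝ) × ℝ) (i : Fin n) : ℝ :=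
  c.resid z i / √|clip c.A (c.ghat z (z i).1)|

/-- The mean of `ε'` over `I₂`. -/
def residMean (z : Fin n → (Fin d → ℝ) × ℝ) : ℝ :=
  (∑ i : Block c.part 1, c.scaledResid z i) / (Fintype.card (Block c.part 1) : ℝ)

/-- The standard deviation of `ε'` over `I₂`. -/
def residSd (z : Fin n → (Fin d → ℝ) × ℝ) : ℝ :=
  √((∑ i : Block c.part 1, (c.scaledResid z i - c.residMean z) ^ 2) /
    (Fintype.card (Block c.part 1) : ℝ))

/-- `ε̃_i`, the standardized version of `ε'_i`. -/
def stdResid (z : Fin n → (Fin d → ℝ) × ℝ) (i : Fin n) : ℝ :=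
  (c.scaledResid z i - c.residMean z) / c.residSd z

/-- The bootstrap sample `(x_i, ỹ_i)`, `i ∈ I₃`, where
`ỹ_i = f̂_A(x_i) + √|ĝ_A(x_i)| ε̃_{κ i}` and `κ` are the drawn indices. -/
def bootSample (z : Fin n → (Fin d → ℝ) × ℝ) (κ : Fin n → Fin n) (i : Block c.part 2) :
    (Fin d → ℝ) × ℝ :=
  ((z i).1, clip c.A (c.fhat z (z i).1)
    + √|clip c.A (c.ghat z (z i).1)| * c.stdResid z (κ i))

/-- `f̂^{(j)}`. -/
def fboot (ω : Outcome d n (c.B + c.Bt)) (j : Fin (c.B + c.Bt)) : (Fin d → ℝ) → ℝ :=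
  c.fitFboot (c.bootSample ω.1 (ω.2.1 j))

/-- The sample `(x_i, (ỹ_i^{(j)} - f̂^{(j)}_A(x_i))²)`, `i ∈ I₃`. -/
def bootResidSample (ω : Outcome d n (c.B + c.Bt)) (j : Fin (c.B + c.Bt)) (i : Block c.part 2) :
    (Fin d → ℝ) × ℝ :=
  ((ω.1 i).1,
    ((c.bootSample ω.1 (ω.2.1 j) i).2 - clip c.A (c.fboot ω j (ω.1 i).1)) ^ 2)

/-- `ĝ^{(j)}`. -/
def gboot (ω : Outcome d n (c.B + c.Bt)) (j : Fin (c.B + c.Bt)) : (Fin d → ℝ) → ℝ :=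
  c.fitGboot (c.bootResidSample ω j)

/-- All fitted networks are least squares solutions in their classes. -/
def FitsLeastSquares (ω : Outcome d n (c.B + c.Bt)) : Prop :=
  IsLeastSquares c.L c.ν (fun i : Block c.part 0 => ω.1 i) (c.fhat ω.1) ∧
  IsLeastSquares c.L' c.ν' (c.residSample ω.1) (c.ghat ω.1) ∧
  ∀ j, IsLeastSquares c.Lboot c.νboot (c.bootSample ω.1 (ω.2.1 j)) (c.fboot ω j) ∧
    IsLeastSquares c.Lboot' c.νboot' (c.bootResidSample ω j) (c.gboot ω j)

/-- The index of the bootstrap sample number `B + 1` (indices start at `0`). -/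
def firstCentre : Fin (c.B + c.Bt) := ⟨c.B, Nat.lt_add_of_pos_right c.Bt_pos⟩

/-- `|I₄|⁻¹ ∑_{i ∈ I₄} (y_i - f̂^{(j)}_{A₁}(x_i))²`, with clipping level `A₁`. -/
def validErr (A₁ : ℝ) (ω : Outcome d n (c.B + c.Bt)) (j : Fin (c.B + c.Bt)) : ℝ :=
  (∑ i : Block c.part 3, ((ω.1 i).2 - clip A₁ (c.fboot ω j (ω.1 i).1)) ^ 2) /
    (Fintype.card (Block c.part 3) : ℝ)

/-- `a₁(α)`: the `(1 - α / (4 B̃))`-quantile of the validation errors of the first `B` samples. -/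
def a1 (A₁ α : ℝ) (ω : Outcome d n (c.B + c.Bt)) : ℝ :=
  empQuantile (fun j : Fin c.B => c.validErr A₁ ω (Fin.castAdd c.Bt j)) (1 - α / (4 * c.Bt))

/-- `a(α)`, with clipping level `A₁` and additive constant `a₀`. -/
def aQ (A₁ α a₀ : ℝ) (ω : Outcome d n (c.B + c.Bt)) : ℝ :=
  |c.a1 A₁ α ω
    + A₁ ^ 2 * √(32 * (Real.log (8 / α) + Real.log c.Bt) / n)
    + A₁ * √(8 * (Real.log (64 / α) + Real.log c.Bt) / n)
    - (∑ i : Block c.part 3, clip A₁ (c.gboot ω c.firstCentre (ω.1 i).1)) /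
        (Fintype.card (Block c.part 3) : ℝ)
    + a₀|

/-- The half-width `Δ(α) = 2 √(a(α) / (α B̃)) + b`. -/
def halfWidth (A₁ α a₀ b : ℝ) (ω : Outcome d n (c.B + c.Bt)) : ℝ :=
  2 * √(c.aQ A₁ α a₀ ω / (α * c.Bt)) + b

/-- The centre `B̃⁻¹ ∑_{j = B+1}^{B+B̃} f̂^{(j)}_A(x)`. -/
def centre (ω : Outcome d n (c.B + c.Bt)) (x : Fin d → ℝ) : ℝ :=
  (∑ j : Fin c.Bt, clip c.A (c.fboot ω (Fin.natAdd c.B j) x)) / (c.Bt : ℝ)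

/-- The half-width with the choices `a₀ = α / (100 log^s n)` and `b = 1 / (100 log^s n)`; the
clipping level in the computation of `a₁(α)` and `a(α)` is `A₁`. -/
def logHalfWidth (A₁ α s : ℝ) (ω : Outcome d n (c.B + c.Bt)) : ℝ :=
  c.halfWidth A₁ α (α / (100 * Real.log n ^ s)) (1 / (100 * Real.log n ^ s)) ω

/-- The event `f*(X) ∈ [centre(X) ± Δ(α)]` for the half-width `logHalfWidth`. -/
def coverEvent (fstar : (Fin d → ℝ) → ℝ) (A₁ α s : ℝ) : Set (Outcome d n (c.B + c.Bt)) :=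
  {ω | fstar ω.2.2 ∈ Set.Icc (c.centre ω ω.2.2 - c.logHalfWidth A₁ α s ω)
    (c.centre ω ω.2.2 + c.logHalfWidth A₁ α s ω)}

end BootConfig

/-! ### Hierarchical composition models, rates, architectures -/

/-- The partial derivative `∂_{i_1} ⋯ ∂_{i_k} m (a)`. -/
def partialDeriv {K : ℕ} (m : EuclideanSpace ℝ (Fin K) → ℝ) {k : ℕ} (idx : Fin k → Fin K)
    (a : EuclideanSpace ℝ (Fin K)) : ℝ :=
  iteratedFDeriv ℝ k m a fun r => EuclideanSpace.single (idx r) (1 : ℝ)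

/-- `m` is `(p, C)`-smooth with `p = q + s`, `q ∈ ℕ`, `0 < s ≤ 1`; its partial derivatives of order
`≤ q` are bounded by `c₂`; and it is Lipschitz with constant `CLip`. -/
def IsSmoothComponent {K : ℕ} (p C c₂ CLip : ℝ) (m : EuclideanSpace ℝ (Fin K) → ℝ) : Prop :=
  ∃ (q : ℕ) (s : ℝ), 0 < s ∧ s ≤ 1 ∧ p = q + s ∧ ContDiff ℝ q m ∧
    (∀ (idx : Fin q → Fin K) (a b : EuclideanSpace ℝ (Fin K)),
      |partialDeriv m idx a - partialDeriv m idx b| ≤ C * ‖a - b‖ ^ s) ∧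
    (∀ k ≤ q, ∀ (idx : Fin k → Fin K) (a : EuclideanSpace ℝ (Fin K)),
      |partialDeriv m idx a| ≤ c₂) ∧
    ∀ a b : EuclideanSpace ℝ (Fin K), |m a - m b| ≤ CLip * ‖a - b‖

/-- `h ∈ 𝓗(l, 𝓟)`, all functions `m` in the composition being smooth components with the constants
`C`, `c₂`, `CLip`. The levels are `l = 1, 2, …`. -/
def IsHierarchical (d : ℕ) (P : Finset (ℝ × ℕ)) (C c₂ CLip : ℝ) :
    ℕ → ((Fin d → ℝ) → ℝ) → Prop
  | 0, _ => False
  | 1, h => ∃ pK ∈ P, ∃ m : EuclideanSpace ℝ (Fin pK.2) → ℝ, IsSmoothComponent pK.1 C c₂ CLip m ∧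
      ∃ π : Fin pK.2 → Fin d, h = fun a => m (WithLp.toLp 2 fun i => a (π i))
  | l + 2, h => ∃ pK ∈ P, ∃ m : EuclideanSpace ℝ (Fin pK.2) → ℝ,
      IsSmoothComponent pK.1 C c₂ CLip m ∧
      ∃ f : Fin pK.2 → (Fin d → ℝ) → ℝ, (∀ i, IsHierarchical d P C c₂ CLip (l + 1) (f i)) ∧
        h = fun a => m (WithLp.toLp 2 fun i => f i a)

/-- `max_{(p,K) ∈ 𝓟} n^{-2p/(2p+K)}`. -/
def rate (P : Finset (ℝ × ℕ)) (hP : P.Nonempty) (n : ℕ) : ℝ :=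
  P.sup' hP fun pK => (n : ℝ) ^ (-(2 * pK.1) / (2 * pK.1 + pK.2))

/-- `max_{(p,K) ∈ 𝓟} n^{K/(2(2p+K))}`. -/
def netSize (P : Finset (ℝ × ℕ)) (hP : P.Nonempty) (n : ℕ) : ℝ :=
  P.sup' hP fun pK => (n : ℝ) ^ ((pK.2 : ℝ) / (2 * (2 * pK.1 + pK.2)))

/-- The two admissible choices of depth and width. -/
def IsArchitecture (c₃ c₄ : ℝ) (P : Finset (ℝ × ℕ)) (hP : P.Nonempty) (n L ν : ℕ) : Prop :=
  (L = ⌈c₃ * Real.log n⌉₊ ∧ ν = ⌈c₄ * netSize P hP n⌉₊) ∨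
  (L = ⌈c₃ * netSize P hP n * Real.log n⌉₊ ∧ ν = ⌈c₄⌉₊)

/-- `u_n = O(poly(log n))` for some polynomial. -/
def IsPolyLog (u : ℕ → ℝ) : Prop :=
  ∃ p : Polynomial ℝ, u =O[atTop] fun n : ℕ => p.eval (Real.log n)

/-- The quantity
`(φ^{1/4} + ψ^{1/4})/(B̃^{1/2} α^{1/2}) + log^{1/4}(1/α)/(B̃^{1/2} α^{1/2} n^{1/4}) + φ^{1/2}/α`. -/
def lengthRate (φ ψ α : ℝ) (Bt n : ℕ) : ℝ :=
  (φ ^ (1 / 4 : ℝ) + ψ ^ (1 / 4 : ℝ)) / ((Bt : ℝ) ^ (1 / 2 : ℝ) * α ^ (1 / 2 : ℝ))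
    + Real.log (1 / α) ^ (1 / 4 : ℝ) /
        ((Bt : ℝ) ^ (1 / 2 : ℝ) * α ^ (1 / 2 : ℝ) * (n : ℝ) ^ (1 / 4 : ℝ))
    + φ ^ (1 / 2 : ℝ) / α

end BootCI

end

/-!
Everything rests on the hypothesis that, with probability `1 - o(n^{-(q+1)})`, the fits to bootstrap
sample `B + 1` have squared `𝓛₂`-error at most `ε_n ≤ c₀ α² / log^{2s} n`. Given the data, the
bootstrap samples are exchangeable, so every one of the `B + B̃ = O(n^q)` fits has this accuracy,
except on an event of probability `o(1 / n) = o(α)` (`exists_fitErr_isLittleO`).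

*Coverage.* The centre averages the clipped fits `f̂^{(j)}`, so by convexity its squared error is at
most `ε_n` as well (`l2sq_sub_centre_le`). The half-width is at least `b(α) = 1 / (100 log^s n)`, and
by Chebyshev's inequality the new covariate falls with probability at most
`ε_n / b(α)² ≤ 10⁴ c₀ α²` at a point where the centre is further than `b(α)` from `f*`
(`one_sub_le_measureReal_coverEvent`). The argument does not see the clipping level used in `a(α)`.

*Length.* Two quantities nearly cancel in `a(α)`. By the bias-variance identity
`E (Y - h(X))² = E g*(X) + ‖f* - h‖²` (`IsRegressionModel.integral_sq_sub`), each validation error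
estimates `E g*(X)` with bias at most `ε_n`, and so does their quantile `a₁(α)`; the validation mean
of the clipped `ĝ^{(B+1)}` estimates `E g*(X)` with bias at most `√ε_n` (`aQ_le`). The bias `√ε_n`
is at most `√c₀ α / log^s n`, which the term `√(1 / (B̃ log^s n))` absorbs
(`two_mul_sqrt_add_le`). The fluctuations of the means over `I₄` are controlled by Hoeffding's
inequality conditionally on `I₁`, `I₂`, `I₃` and the draws, uniformly over the polynomially many
bootstrap samples (`law_abs_validMean_sub_ge_le`, `measureReal_lt_aQ_le`). Like the deterministic
terms of `a(α)` they are of order `n^{-1/2}` up to powers of `log n`, because the clipping level is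
polylogarithmic; and `n^{-1/2} ≤ φ_n^{1/2}`, as no rate `n^{-2p/(2p+K)}` is faster than `1 / n`
(`two_mul_sqrt_noise_le`). One more power of `log n` in the polynomial turns `O_P` into `o_P`.
-/

namespace BootCI

/-! ### Clipping, quantiles and Hoeffding's inequality -/

theorem measurable_clip (A : ℝ) : Measurable (clip A) := by
  unfold clip; fun_prop

theorem abs_clip_le {A : ℝ} (hA : 0 ≤ A) (t : ℝ) : |clip A t| ≤ A := by
  rw [abs_le]
  exact ⟨le_max_left _ _, max_le (by linarith) (min_le_left _ _)⟩

/-- An empirical quantile of positive order lies between any bounds of the sample. -/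
theorem empQuantile_mem_Icc {N : ℕ} (hN : 0 < N) {v : Fin N → ℝ} {τ lo hi : ℝ} (hτ : 0 < τ)
    (hτ1 : τ ≤ 1) (hv : ∀ j, v j ∈ Set.Icc lo hi) : empQuantile v τ ∈ Set.Icc lo hi := by
  have hmem : hi ∈ {t | τ * N ≤ ((Finset.univ.filter fun j => v j ≤ t).card : ℝ)} := by
    have : (Finset.univ.filter fun j => v j ≤ hi) = Finset.univ :=
      Finset.filter_true_of_mem fun j _ => (hv j).2
    simp only [Set.mem_ofPred_eq, this, Finset.card_univ, Fintype.card_fin]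
    exact mul_le_of_le_one_left (Nat.cast_nonneg _) hτ1
  have hlo : ∀ t ∈ {t | τ * N ≤ ((Finset.univ.filter fun j => v j ≤ t).card : ℝ)}, lo ≤ t := by
    intro t ht
    have hpos : (0 : ℝ) < ((Finset.univ.filter fun j => v j ≤ t).card : ℝ) :=
      lt_of_lt_of_le (mul_pos hτ (Nat.cast_pos.2 hN)) ht
    obtain ⟨j, hj⟩ := Finset.card_pos.1 (Nat.cast_pos.1 hpos)
    exact (hv j).1.trans (Finset.mem_filter.1 hj).2
  exact ⟨le_csInf ⟨hi, hmem⟩ hlo, csInf_le ⟨lo, hlo⟩ hmem⟩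

/-- Hoeffding's inequality for the mean of a bounded function of i.i.d. variables. -/
theorem measureReal_pi_abs_mean_sub_integral_ge_le {Z ι : Type*} [MeasurableSpace Z] [Fintype ι]
    [Nonempty ι] (ρ : Measure Z) [IsProbabilityMeasure ρ] {H : Z → ℝ} (hH : Measurable H)
    {a b t : ℝ} (hab : ∀ᵐ z ∂ρ, H z ∈ Set.Icc a b) (ht : 0 ≤ t) :
    (Measure.pi fun _ : ι => ρ).real
      {z | t ≤ |(∑ i, H (z i)) / (Fintype.card ι : ℝ) - ∫ z, H z ∂ρ|} ≤
      2 * Real.exp (-(2 * Fintype.card ι * t ^ 2 / (b - a) ^ 2)) := by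
  set m : ℝ := ((Fintype.card ι : ℕ) : ℝ) with hm
  have hm0 : 0 < m := Nat.cast_pos.2 Fintype.card_pos
  have key : ∀ (G : Z → ℝ), Measurable G → ∀ c : NNReal, HasSubgaussianMGF G c ρ →
      (Measure.pi fun _ : ι => ρ).real {z | m * t ≤ ∑ i, G (z i)} ≤
        Real.exp (-(m * t) ^ 2 / (2 * (m * c))) := by
    intro G hG c hc
    have hind : iIndepFun (fun i (z : ι → Z) => G (z i)) (Measure.pi fun _ : ι => ρ) :=
      iIndepFun_pi fun _ => hG.aemeasurable
    have hsub : ∀ i ∈ (Finset.univ : Finset ι),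
        HasSubgaussianMGF (fun z : ι → Z => G (z i)) c (Measure.pi fun _ : ι => ρ) := by
      intro i _
      have hmp := measurePreserving_eval (fun _ : ι => ρ) i
      refine HasSubgaussianMGF.of_map (X := G) hmp.measurable.aemeasurable ?_
      rw [hmp.map_eq]
      exact hc
    have := HasSubgaussianMGF.measure_sum_ge_le_of_iIndepFun hind (c := fun _ => c) hsub
      (mul_nonneg hm0.le ht)
    simpa [hm] using this
  have hs := hasSubgaussianMGF_of_mem_Icc hH.aemeasurable hab
  have hcval : (((‖b - a‖₊ / 2) ^ 2 : NNReal) : ℝ) = (b - a) ^ 2 / 4 := by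
    push_cast
    rw [Real.norm_eq_abs, div_pow, sq_abs]; norm_num
  have hexp : -(m * t) ^ 2 / (2 * (m * (((‖b - a‖₊ / 2) ^ 2 : NNReal) : ℝ))) =
      -(2 * m * t ^ 2 / (b - a) ^ 2) := by
    rw [hcval]
    by_cases hba : b - a = 0
    · simp [hba]
    · field_simp
      ring
  have h1 := key _ (hH.sub_const _) _ hs
  have h2 := key _ (hH.sub_const _).neg _ hs.neg
  rw [hexp] at h1 h2
  have hsubset : {z : ι → Z | t ≤ |(∑ i, H (z i)) / m - ∫ z, H z ∂ρ|} ⊆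
      {z | m * t ≤ ∑ i, (H (z i) - ∫ z, H z ∂ρ)} ∪
        {z | m * t ≤ ∑ i, (-fun z => H z - ∫ z, H z ∂ρ) (z i)} := by
    intro z hz
    have hsum : ∑ i, (H (z i) - ∫ z, H z ∂ρ) = m * ((∑ i, H (z i)) / m - ∫ z, H z ∂ρ) := by
      rw [Finset.sum_sub_distrib, mul_sub, mul_div_cancel₀ _ hm0.ne']
      simp [hm]
    simp only [Set.mem_union, Set.mem_ofPred_eq, Pi.neg_apply, Finset.sum_neg_distrib, hsum]
    rw [Set.mem_ofPred_eq] at hz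
    rcases le_abs.1 hz with h | h
    · exact Or.inl (mul_le_mul_of_nonneg_left h hm0.le)
    · right
      rw [← mul_neg]
      exact mul_le_mul_of_nonneg_left h hm0.le
  calc _ ≤ _ := measureReal_mono hsubset
    _ ≤ _ := measureReal_union_le _ _
    _ ≤ _ := add_le_add h1 h2
    _ = _ := by ring

/-! ### The regression model -/

section Model

variable {d : ℕ} {ρ : Measure ((Fin d → ℝ) × ℝ)} {fstar gstar : (Fin d → ℝ) → ℝ} {A : ℝ}

theorem l2sq_nonneg (h : (Fin d → ℝ) → ℝ) : 0 ≤ l2sq ρ h :=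
  integral_nonneg fun _ => sq_nonneg _

/-- A function of the covariate can be integrated against `ρ` or against the law of `X`. -/
theorem integral_fst_eq {h : (Fin d → ℝ) → ℝ} (hh : Measurable h) :
    ∫ x, h x ∂ρ.fst = ∫ z, h z.1 ∂ρ := by
  rw [Measure.fst, integral_map measurable_fst.aemeasurable hh.aestronglyMeasurable]

theorem ae_fst_iff {p : (Fin d → ℝ) → Prop} (hp : MeasurableSet {x | p x}) :
    (∀ᵐ x ∂ρ.fst, p x) ↔ ∀ᵐ z ∂ρ, p z.1 := by
  rw [Measure.fst, ae_map_iff measurable_fst.aemeasurable hp]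

theorem integrable_of_ae_abs_le {Ω : Type*} [MeasurableSpace Ω] {μ : Measure Ω}
    [IsFiniteMeasure μ] {h : Ω → ℝ} (hh : Measurable h) {R : ℝ} (hR : ∀ᵐ x ∂μ, |h x| ≤ R) :
    Integrable h μ :=
  Integrable.of_bound hh.aestronglyMeasurable R (by simpa using hR)

namespace IsRegressionModel

variable (hM : IsRegressionModel ρ fstar gstar)
include hM

theorem abs_f_le (hA : ∀ᵐ z ∂ρ, |z.2| ≤ A) : ∀ᵐ z ∂ρ, |fstar z.1| ≤ A := by
  have := ae_bdd_abs_condExp_of_ae_bdd_abs (m := MeasurableSpace.comap Prod.fst inferInstance)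
    (R := A) (f := fun z : (Fin d → ℝ) × ℝ => z.2) hA
  filter_upwards [this, hM.mean] with z h1 h2
  rw [← h2]; exact h1

theorem abs_g_le (hA : ∀ᵐ z ∂ρ, |z.2| ≤ A) : ∀ᵐ z ∂ρ, |gstar z.1| ≤ 4 * A ^ 2 := by
  have hb : ∀ᵐ z ∂ρ, |(z.2 - fstar z.1) ^ 2| ≤ 4 * A ^ 2 := by
    filter_upwards [hA, hM.abs_f_le hA] with z h1 h2
    rw [abs_of_nonneg (sq_nonneg _)]
    rw [abs_le] at h1 h2
    nlinarith
  have := ae_bdd_abs_condExp_of_ae_bdd_abs (m := MeasurableSpace.comap Prod.fst inferInstance)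
    (R := 4 * A ^ 2) (f := fun z => (z.2 - fstar z.1) ^ 2) hb
  filter_upwards [this, hM.var] with z h1 h2
  rw [← h2]; exact h1

variable [IsProbabilityMeasure ρ]

theorem integral_sq_sub_f :
    ∫ z, (z.2 - fstar z.1) ^ 2 ∂ρ = ∫ x, gstar x ∂ρ.fst := by
  rw [integral_fst_eq hM.measurable_g, ← integral_condExp measurable_fst.comap_le]
  exact integral_congr_ae hM.var

/-- The error `Y - f*(X)` is orthogonal to bounded functions of the covariate. -/
theorem integral_sub_f_mul (hA : ∀ᵐ z ∂ρ, |z.2| ≤ A) {k : (Fin d → ℝ) → ℝ} (hk : Measurable k)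
    {R : ℝ} (hR : ∀ᵐ z ∂ρ, |k z.1| ≤ R) : ∫ z, (z.2 - fstar z.1) * k z.1 ∂ρ = 0 := by
  have hy : Integrable (fun z : (Fin d → ℝ) × ℝ => z.2) ρ :=
    integrable_of_ae_abs_le measurable_snd hA
  have hf : Integrable (fun z : (Fin d → ℝ) × ℝ => fstar z.1) ρ :=
    integrable_of_ae_abs_le (hM.measurable_f.comp measurable_fst) (hM.abs_f_le hA)
  have hkm : StronglyMeasurable[MeasurableSpace.comap Prod.fst inferInstance]
      (fun z : (Fin d → ℝ) × ℝ => k z.1) :=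
    (hk.comp (comap_measurable _)).stronglyMeasurable
  have hyk : Integrable (fun z : (Fin d → ℝ) × ℝ => z.2 * k z.1) ρ :=
    hy.mul_bdd (c := R) (hk.comp measurable_fst).aestronglyMeasurable (by simpa using hR)
  have hfk : Integrable (fun z : (Fin d → ℝ) × ℝ => fstar z.1 * k z.1) ρ :=
    hf.mul_bdd (c := R) (hk.comp measurable_fst).aestronglyMeasurable (by simpa using hR)
  have hpull := condExp_mul_of_stronglyMeasurable_right (μ := ρ) hkm hyk hy
  have : ∫ z, z.2 * k z.1 ∂ρ = ∫ z, fstar z.1 * k z.1 ∂ρ := by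
    rw [← integral_condExp measurable_fst.comap_le]
    refine integral_congr_ae ?_
    filter_upwards [hpull, hM.mean] with z h1 h2
    rw [← h2]
    exact h1
  simp_rw [sub_mul]
  rw [integral_sub hyk hfk, this, sub_self]

/-- The bias-variance identity `E (Y - h(X))² = E g*(X) + ‖f* - h‖²`. -/
theorem integral_sq_sub (hA : ∀ᵐ z ∂ρ, |z.2| ≤ A) {h : (Fin d → ℝ) → ℝ} (hh : Measurable h)
    (hb : ∀ x, |h x| ≤ A) :
    ∫ z, (z.2 - h z.1) ^ 2 ∂ρ = ∫ x, gstar x ∂ρ.fst + l2sq ρ fun x => fstar x - h x := by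
  have hfm := hM.measurable_f
  have hk : Measurable fun x => fstar x - h x := hfm.sub hh
  have hfA := hM.abs_f_le hA
  have hkR : ∀ᵐ z ∂ρ, |fstar z.1 - h z.1| ≤ A + A := by
    filter_upwards [hfA] with z hz
    exact (abs_sub _ _).trans (add_le_add hz (hb _))
  have h1 : Integrable (fun z : (Fin d → ℝ) × ℝ => (z.2 - fstar z.1) ^ 2) ρ := by
    refine integrable_of_ae_abs_le (by fun_prop) (R := (A + A) ^ 2) ?_
    filter_upwards [hA, hfA] with z hz hz'
    rw [abs_pow]
    exact pow_le_pow_left₀ (abs_nonneg _) ((abs_sub _ _).trans (add_le_add hz hz')) 2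
  have h2 : Integrable (fun z : (Fin d → ℝ) × ℝ => (z.2 - fstar z.1) * (fstar z.1 - h z.1)) ρ := by
    refine integrable_of_ae_abs_le (by fun_prop) (R := (A + A) * (A + A)) ?_
    filter_upwards [hA, hfA, hkR] with z hz hz' hz''
    rw [abs_mul]
    exact mul_le_mul ((abs_sub _ _).trans (add_le_add hz hz')) hz'' (abs_nonneg _)
      ((abs_nonneg _).trans hz'')
  have h3 : Integrable (fun z : (Fin d → ℝ) × ℝ => (fstar z.1 - h z.1) ^ 2) ρ := by
    refine integrable_of_ae_abs_le (by fun_prop) (R := (A + A) ^ 2) ?_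
    filter_upwards [hkR] with z hz
    rw [abs_pow]
    exact pow_le_pow_left₀ (abs_nonneg _) hz 2
  have hsplit : ∀ z : (Fin d → ℝ) × ℝ, (z.2 - h z.1) ^ 2 = (z.2 - fstar z.1) ^ 2 +
      2 * ((z.2 - fstar z.1) * (fstar z.1 - h z.1)) + (fstar z.1 - h z.1) ^ 2 := by
    intro z; ring
  simp_rw [hsplit]
  have h12 := h1.add (h2.const_mul 2)
  simp only [Pi.add_def] at h12
  rw [integral_add h12 h3, integral_add h1 (h2.const_mul 2),
    integral_const_mul, hM.integral_sub_f_mul hA hk hkR, hM.integral_sq_sub_f, l2sq,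
    integral_fst_eq (hk.pow_const 2)]
  ring

end IsRegressionModel

variable [IsProbabilityMeasure ρ]

theorem level_nonneg (hA : ∀ᵐ z ∂ρ, |z.2| ≤ A) : 0 ≤ A := by
  obtain ⟨z, hz⟩ := hA.exists
  exact (abs_nonneg _).trans hz

/-- Means are closer than the `𝓛₂`-distance. -/
theorem abs_integral_sub_le_sqrt_l2sq {g h : (Fin d → ℝ) → ℝ} (hg : Measurable g)
    (hh : Measurable h) {R : ℝ} (hgR : ∀ᵐ x ∂ρ.fst, |g x| ≤ R) (hhR : ∀ᵐ x ∂ρ.fst, |h x| ≤ R) :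
    |∫ x, g x ∂ρ.fst - ∫ x, h x ∂ρ.fst| ≤ √(l2sq ρ fun x => g x - h x) := by
  have hgi := integrable_of_ae_abs_le hg hgR
  have hhi := integrable_of_ae_abs_le hh hhR
  rw [← integral_sub hgi hhi]
  apply Real.abs_le_sqrt
  have hL : MemLp (fun x => g x - h x) 2 ρ.fst := by
    refine MemLp.of_bound (hg.sub hh).aestronglyMeasurable (R + R) ?_
    filter_upwards [hgR, hhR] with x h1 h2
    exact (abs_sub _ _).trans (add_le_add h1 h2)
  have := variance_nonneg (fun x => g x - h x) ρ.fst
  rw [variance_eq_sub hL] at this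
  unfold l2sq
  have h2 : ∫ x, (g x - h x) ^ 2 ∂ρ.fst = ρ.fst[(fun x => g x - h x) ^ 2] := rfl
  rw [h2]
  linarith

end Model

/-! ### Measurability of the bootstrap fits and their dependence on the data -/

namespace BootConfig

variable {d n : ℕ} (c : BootConfig d n)

theorem measurable_fhat :
    Measurable fun p : (Fin n → (Fin d → ℝ) × ℝ) × (Fin d → ℝ) => c.fhat p.1 p.2 := by
  have h : Measurable fun p : (Fin n → (Fin d → ℝ) × ℝ) × (Fin d → ℝ) =>
      ((fun i : Block c.part 0 => p.1 i, p.2) : (Block c.part 0 → _) × _) := by fun_prop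
  exact c.measurable_fitF.comp h

theorem measurable_resid (i : Fin n) : Measurable fun z => c.resid z i := by
  have h1 : Measurable fun z : Fin n → (Fin d → ℝ) × ℝ => (z, (z i).1) := by fun_prop
  have h2 := (measurable_clip c.A).comp (c.measurable_fhat.comp h1)
  exact (measurable_snd.comp (measurable_pi_apply i)).sub h2

theorem measurable_residSample : Measurable c.residSample := by
  refine measurable_pi_lambda _ fun i => ?_
  exact (measurable_fst.comp (measurable_pi_apply _)).prodMk ((c.measurable_resid i).pow_const 2)

theorem measurable_ghat :
    Measurable fun p : (Fin n → (Fin d → ℝ) × ℝ) × (Fin d → ℝ) => c.ghat p.1 p.2 :=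
  c.measurable_fitG.comp ((c.measurable_residSample.comp measurable_fst).prodMk measurable_snd)

theorem measurable_scaledResid (i : Fin n) : Measurable fun z => c.scaledResid z i := by
  have h1 : Measurable fun z : Fin n → (Fin d → ℝ) × ℝ => (z, (z i).1) := by fun_prop
  have h2 := (measurable_clip c.A).comp (c.measurable_ghat.comp h1)
  exact (c.measurable_resid i).div (h2.abs.sqrt)

theorem measurable_stdResid (i : Fin n) : Measurable fun z => c.stdResid z i := by
  have h0 := c.measurable_scaledResid
  have h1 : Measurable c.residMean :=
    (Finset.measurable_fun_sum _ fun (i : Block c.part 1) _ => h0 i).div_const _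
  have h2 : Measurable c.residSd :=
    ((Finset.measurable_fun_sum _ fun (i : Block c.part 1) _ =>
      ((h0 i).sub h1).pow_const 2).div_const _).sqrt
  exact ((h0 i).sub h1).div h2

theorem measurable_bootSample :
    Measurable fun p : (Fin n → (Fin d → ℝ) × ℝ) × (Fin n → Fin n) => c.bootSample p.1 p.2 := by
  refine measurable_pi_lambda _ fun i => ?_
  have h1 : Measurable fun z : Fin n → (Fin d → ℝ) × ℝ => (z, (z i).1) := by fun_prop
  have hf := (measurable_clip c.A).comp (c.measurable_fhat.comp h1)
  have hg := ((measurable_clip c.A).comp (c.measurable_ghat.comp h1)).abs.sqrt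
  have hs : Measurable fun p : (Fin n → (Fin d → ℝ) × ℝ) × Fin n => c.stdResid p.1 p.2 :=
    measurable_from_prod_countable_left fun k => c.measurable_stdResid k
  have hs' : Measurable fun p : (Fin n → (Fin d → ℝ) × ℝ) × (Fin n → Fin n) =>
      c.stdResid p.1 (p.2 i) :=
    hs.comp (g := fun p : (Fin n → (Fin d → ℝ) × ℝ) × Fin n => c.stdResid p.1 p.2)
      (f := fun p : (Fin n → (Fin d → ℝ) × ℝ) × (Fin n → Fin n) => (p.1, p.2 i))
      (measurable_fst.prodMk ((measurable_pi_apply _).comp measurable_snd))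
  refine Measurable.prodMk (by fun_prop) ?_
  exact (hf.comp measurable_fst).add ((hg.comp measurable_fst).mul hs')

theorem measurable_fboot (j : Fin (c.B + c.Bt)) :
    Measurable fun p : Outcome d n (c.B + c.Bt) × (Fin d → ℝ) => c.fboot p.1 j p.2 := by
  have h : Measurable fun ω : Outcome d n (c.B + c.Bt) => c.bootSample ω.1 (ω.2.1 j) :=
    c.measurable_bootSample.comp (f := fun ω : Outcome d n (c.B + c.Bt) => (ω.1, ω.2.1 j))
      (by fun_prop)
  exact c.measurable_fitFboot.comp ((h.comp measurable_fst).prodMk measurable_snd)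

theorem measurable_gboot (j : Fin (c.B + c.Bt)) :
    Measurable fun p : Outcome d n (c.B + c.Bt) × (Fin d → ℝ) => c.gboot p.1 j p.2 := by
  have h : Measurable fun ω : Outcome d n (c.B + c.Bt) => c.bootSample ω.1 (ω.2.1 j) :=
    c.measurable_bootSample.comp (f := fun ω : Outcome d n (c.B + c.Bt) => (ω.1, ω.2.1 j))
      (by fun_prop)
  have h2 : Measurable fun ω : Outcome d n (c.B + c.Bt) => c.bootResidSample ω j := by
    refine measurable_pi_lambda _ fun i => ?_
    have h3 : Measurable fun ω : Outcome d n (c.B + c.Bt) => (ω, (ω.1 i).1) := by fun_prop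
    have h4 := (measurable_clip c.A).comp ((c.measurable_fboot j).comp h3)
    have h5 : Measurable fun ω : Outcome d n (c.B + c.Bt) => (c.bootSample ω.1 (ω.2.1 j) i).2 :=
      measurable_snd.comp ((measurable_pi_apply i).comp h)
    exact Measurable.prodMk (by fun_prop) ((h5.sub h4).pow_const 2)
  exact c.measurable_fitGboot.comp ((h2.comp measurable_fst).prodMk measurable_snd)

section Locality

variable {c} {z z' : Fin n → (Fin d → ℝ) × ℝ}

theorem fhat_congr (h : ∀ i, c.part i ≠ 3 → z i = z' i) : c.fhat z = c.fhat z' := by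
  unfold fhat
  congr 1
  funext i
  exact h _ (by rw [i.2]; decide)

theorem resid_congr (h : ∀ i, c.part i ≠ 3 → z i = z' i) {i : Fin n} (hi : c.part i ≠ 3) :
    c.resid z i = c.resid z' i := by
  unfold resid
  rw [fhat_congr h, h i hi]

theorem ghat_congr (h : ∀ i, c.part i ≠ 3 → z i = z' i) : c.ghat z = c.ghat z' := by
  unfold ghat
  congr 1
  funext i
  have hi : c.part i ≠ 3 := by rw [i.2]; decide
  unfold residSample
  rw [resid_congr h hi, h _ hi]

theorem scaledResid_congr (h : ∀ i, c.part i ≠ 3 → z i = z' i) {i : Fin n} (hi : c.part i ≠ 3) :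
    c.scaledResid z i = c.scaledResid z' i := by
  unfold scaledResid
  rw [resid_congr h hi, ghat_congr h, h i hi]

theorem stdResid_congr (h : ∀ i, c.part i ≠ 3 → z i = z' i) {i : Fin n} (hi : c.part i ≠ 3) :
    c.stdResid z i = c.stdResid z' i := by
  have h1 : ∀ i : Block c.part 1, c.scaledResid z i = c.scaledResid z' i := fun i =>
    scaledResid_congr h (by rw [i.2]; decide)
  unfold stdResid residSd residMean
  simp_rw [h1, scaledResid_congr h hi]

theorem bootSample_congr (h : ∀ i, c.part i ≠ 3 → z i = z' i) {κ : Fin n → Fin n}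
    (hκ : ∀ i, c.part (κ i) = 1) : c.bootSample z κ = c.bootSample z' κ := by
  funext i
  have hi : c.part i ≠ 3 := by rw [i.2]; decide
  unfold bootSample
  rw [fhat_congr h, ghat_congr h, h _ hi,
    stdResid_congr h (i := κ i) (by rw [hκ]; decide)]

/-- As long as only residuals with index in `I₂` are drawn, the bootstrap fits do not depend on the
data with index in `I₄`. -/
theorem fboot_congr (h : ∀ i, c.part i ≠ 3 → z i = z' i)
    {κ : Fin (c.B + c.Bt) → Fin n → Fin n} {j : Fin (c.B + c.Bt)}
    (hκ : ∀ i, c.part (κ j i) = 1) (x : Fin d → ℝ) :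
    c.fboot (z, κ, x) j = c.fboot (z', κ, x) j := by
  unfold fboot
  simp only [bootSample_congr h hκ]

theorem gboot_congr (h : ∀ i, c.part i ≠ 3 → z i = z' i)
    {κ : Fin (c.B + c.Bt) → Fin n → Fin n} {j : Fin (c.B + c.Bt)}
    (hκ : ∀ i, c.part (κ j i) = 1) (x : Fin d → ℝ) :
    c.gboot (z, κ, x) j = c.gboot (z', κ, x) j := by
  unfold gboot
  congr 1
  funext i
  have hi : c.part i ≠ 3 := by rw [i.2]; decide
  unfold bootResidSample
  simp only [fboot_congr h hκ, bootSample_congr h hκ, h _ hi]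

end Locality

end BootConfig

/-! ### The joint law -/

/-- A bound for the conditional probabilities given the second coordinate bounds the probability. -/
theorem prod_apply_le_of_forall_snd {α β : Type*} [MeasurableSpace α] [MeasurableSpace β]
    (μ : Measure α) (ν : Measure β) [IsProbabilityMeasure μ] [IsProbabilityMeasure ν]
    {S : Set (α × β)} (hS : MeasurableSet S) {r : ENNReal} (hr : ∀ b, μ {a | (a, b) ∈ S} ≤ r) :
    μ.prod ν S ≤ r := by
  rw [Measure.prod_apply_symm hS]
  exact (lintegral_mono (g := fun _ => r) fun b => hr b).trans (by simp)

namespace BootConfig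

variable {d n : ℕ} (c : BootConfig d n)

theorem isProbabilityMeasure_law (ρ : Measure ((Fin d → ℝ) × ℝ)) [IsProbabilityMeasure ρ]
    (h : Nonempty (Block c.part 1)) : IsProbabilityMeasure (c.law ρ) := by
  have : IsProbabilityMeasure (uniformOn {i | c.part i = 1}) :=
    isProbabilityMeasure_uniformOn (Set.toFinite _) (h.elim fun i => ⟨i.1, i.2⟩)
  unfold law
  infer_instance

/-- Bootstrap indices are drawn from `I₂`. -/
theorem ae_draws (ρ : Measure ((Fin d → ℝ) × ℝ)) [IsProbabilityMeasure ρ]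
    (h : Nonempty (Block c.part 1)) :
    ∀ᵐ ω ∂(c.law ρ), ∀ j i, c.part (ω.2.1 j i) = 1 := by
  have : IsProbabilityMeasure (uniformOn {i | c.part i = 1}) :=
    isProbabilityMeasure_uniformOn (Set.toFinite _) (h.elim fun i => ⟨i.1, i.2⟩)
  rw [ae_all_iff]
  intro j
  rw [ae_all_iff]
  intro i
  have h1 : ∀ᵐ k ∂(uniformOn {i | c.part i = 1}), c.part k = 1 :=
    ae_cond_mem (s := {i | c.part i = 1}) (MeasurableSet.of_discrete)
  have h2 := (Measure.quasiMeasurePreserving_eval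
    (fun _ : Fin n => uniformOn {i | c.part i = 1}) i).ae h1
  have h3 := (Measure.quasiMeasurePreserving_eval (fun _ : Fin (c.B + c.Bt) =>
    Measure.pi fun _ : Fin n => uniformOn {i | c.part i = 1}) j).ae h2
  exact Measure.quasiMeasurePreserving_snd.ae (Measure.quasiMeasurePreserving_fst.ae h3)

/-- A bound for the probability of an event, given that it holds conditionally on the draws and on
the new covariate. -/
theorem law_le_of_forall_draws {ρ : Measure ((Fin d → ℝ) × ℝ)} [IsProbabilityMeasure ρ]
    (h : Nonempty (Block c.part 1)) {S : Set (Outcome d n (c.B + c.Bt))} (hS : MeasurableSet S)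
    {r : ENNReal}
    (hr : ∀ κ x, (∀ j i, c.part (κ j i) = 1) →
      (Measure.pi fun _ : Fin n => ρ) {z | (z, κ, x) ∈ S} ≤ r) : c.law ρ S ≤ r := by
  have : IsProbabilityMeasure (uniformOn {i | c.part i = 1}) :=
    isProbabilityMeasure_uniformOn (Set.toFinite _) (h.elim fun i => ⟨i.1, i.2⟩)
  set D : Set (Outcome d n (c.B + c.Bt)) := {ω | ∀ j i, c.part (ω.2.1 j i) = 1} with hD
  have hDm : MeasurableSet D := by
    have : Measurable fun ω : Outcome d n (c.B + c.Bt) => ω.2.1 := by fun_prop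
    exact this (t := {κ | ∀ j i, c.part (κ j i) = 1}) (Set.toFinite _).measurableSet
  have hSD : c.law ρ S ≤ c.law ρ (S ∩ D) := by
    refine measure_mono_ae ?_
    filter_upwards [c.ae_draws ρ h] with ω hω hS using ⟨hS, hω⟩
  refine hSD.trans ?_
  refine prod_apply_le_of_forall_snd (Measure.pi fun _ : Fin n => ρ) _ (hS.inter hDm) fun k => ?_
  by_cases hk : ∀ j i, c.part (k.1 j i) = 1
  · exact (measure_mono fun z hz => hz.1).trans (hr k.1 k.2 hk)
  · have : {z : Fin n → (Fin d → ℝ) × ℝ | (z, k) ∈ S ∩ D} = ∅ :=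
      Set.eq_empty_of_forall_notMem fun z hz => hk hz.2
    rw [this]
    simp

/-- A bound for the probability of an event, given that it holds conditionally on the data and on
the draws. -/
theorem law_le_of_forall_covariate {ρ : Measure ((Fin d → ℝ) × ℝ)} [IsProbabilityMeasure ρ]
    (h : Nonempty (Block c.part 1)) {S : Set (Outcome d n (c.B + c.Bt))} (hS : MeasurableSet S)
    {r : ENNReal} (hr : ∀ z κ, ρ.fst {x | (z, κ, x) ∈ S} ≤ r) : c.law ρ S ≤ r := by
  have : IsProbabilityMeasure (uniformOn {i | c.part i = 1}) :=
    isProbabilityMeasure_uniformOn (Set.toFinite _) (h.elim fun i => ⟨i.1, i.2⟩)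
  unfold law
  rw [Measure.prod_apply hS]
  refine (lintegral_mono (g := fun _ => r) fun z => ?_).trans (by simp)
  rw [Measure.prod_apply (measurable_prodMk_left hS)]
  exact (lintegral_mono (g := fun _ => r) fun κ => hr z κ).trans (by simp)

/-- Hoeffding's inequality for the mean over `I₄` of a function that may depend on the remaining
data and on the draws. -/
theorem law_abs_validMean_sub_ge_le {ρ : Measure ((Fin d → ℝ) × ℝ)} [IsProbabilityMeasure ρ]
    (h1 : Nonempty (Block c.part 1)) (h3 : Nonempty (Block c.part 3))
    {H : Outcome d n (c.B + c.Bt) → (Fin d → ℝ) × ℝ → ℝ} (hH : Measurable (Function.uncurry H))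
    (hloc : ∀ z z' κ x, (∀ i, c.part i ≠ 3 → z i = z' i) → (∀ j i, c.part (κ j i) = 1) →
      H (z, κ, x) = H (z', κ, x))
    {a b t : ℝ} (hab : ∀ ω, ∀ᵐ w ∂ρ, H ω w ∈ Set.Icc a b) (ht : 0 ≤ t) :
    (c.law ρ).real {ω | t ≤ |(∑ i : Block c.part 3, H ω (ω.1 i)) /
        (Fintype.card (Block c.part 3) : ℝ) - ∫ w, H ω w ∂ρ|} ≤
      2 * Real.exp (-(2 * Fintype.card (Block c.part 3) * t ^ 2 / (b - a) ^ 2)) := by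
  set r := 2 * Real.exp (-(2 * Fintype.card (Block c.part 3) * t ^ 2 / (b - a) ^ 2)) with hr
  have hr0 : 0 ≤ r := by positivity
  have hHi : ∀ i : Block c.part 3, Measurable fun ω => H ω (ω.1 i) := fun i =>
    hH.comp (f := fun ω : Outcome d n (c.B + c.Bt) => (ω, ω.1 i)) (by fun_prop)
  have hint : Measurable fun ω => ∫ w, H ω w ∂ρ :=
    (hH.stronglyMeasurable.integral_prod_right).measurable
  have hS : MeasurableSet {ω | t ≤ |(∑ i : Block c.part 3, H ω (ω.1 i)) /
        (Fintype.card (Block c.part 3) : ℝ) - ∫ w, H ω w ∂ρ|} :=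
    measurableSet_le measurable_const
      (((Finset.measurable_fun_sum _ fun i _ => hHi i).div_const _).sub hint).abs
  refine ENNReal.toReal_le_of_le_ofReal hr0 (c.law_le_of_forall_draws h1 hS fun κ x hκ => ?_)
  -- Split off the coordinates in `I₄` and argue conditionally on the others.
  have he := measurePreserving_piEquivPiSubtypeProd (fun _ : Fin n => ρ) (fun i => c.part i = 3)
  have hT := (measurable_prodMk_right (y := (κ, x)) :
    Measurable fun z : Fin n → (Fin d → ℝ) × ℝ => (z, (κ, x))) hS
  set e := MeasurableEquiv.piEquivPiSubtypeProd (fun _ : Fin n => (Fin d → ℝ) × ℝ)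
    (fun i => c.part i = 3) with he_def
  refine ((he.symm e).measure_preimage hT.nullMeasurableSet).symm.le.trans ?_
  rw [Measure.prod_apply_symm (e.symm.measurable hT)]
  refine (lintegral_mono (g := fun _ => ENNReal.ofReal r) fun w => ?_).trans (by simp)
  set z₀ := e.symm (fun _ => 0, w) with hz₀
  have hon : ∀ (v : Block c.part 3 → (Fin d → ℝ) × ℝ) (i : Block c.part 3),
      e.symm (v, w) i = v i := by
    intro v i
    have := congrFun (congrArg Prod.fst (e.apply_symm_apply (v, w))) i
    exact this
  have hoff : ∀ (v : Block c.part 3 → (Fin d → ℝ) × ℝ) (i : Fin n), c.part i ≠ 3 →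
      e.symm (v, w) i = z₀ i := by
    intro v i hi
    have h1 := congrFun (congrArg Prod.snd (e.apply_symm_apply (v, w))) ⟨i, hi⟩
    have h2 := congrFun (congrArg Prod.snd (e.apply_symm_apply (fun _ => 0, w))) ⟨i, hi⟩
    exact h1.trans h2.symm
  have hhoef := measureReal_pi_abs_mean_sub_integral_ge_le (ι := Block c.part 3) ρ
    (H := H (z₀, κ, x)) (hH.comp measurable_prodMk_left) (hab _) ht
  refine le_trans (le_of_eq ?_)
    ((ENNReal.le_ofReal_iff_toReal_le (measure_ne_top _ _) hr0).2 hhoef)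
  congr 1
  ext v
  have hHv : H (e.symm (v, w), κ, x) = H (z₀, κ, x) := hloc _ _ _ _ (hoff v) hκ
  simp only [Set.mem_preimage, Set.mem_ofPred_eq, hHv, hon]

/-! ### Exchangeability of the bootstrap fits -/

variable {ρ : Measure ((Fin d → ℝ) × ℝ)} {fstar gstar : (Fin d → ℝ) → ℝ}

theorem fboot_eq_of_draws {ω ω' : Outcome d n (c.B + c.Bt)} {j j' : Fin (c.B + c.Bt)}
    (h1 : ω.1 = ω'.1) (h2 : ω.2.1 j = ω'.2.1 j') : c.fboot ω j = c.fboot ω' j' := by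
  unfold fboot
  rw [h1, h2]

theorem gboot_eq_of_draws {ω ω' : Outcome d n (c.B + c.Bt)} {j j' : Fin (c.B + c.Bt)}
    (h1 : ω.1 = ω'.1) (h2 : ω.2.1 j = ω'.2.1 j') : c.gboot ω j = c.gboot ω' j' := by
  have h3 := c.fboot_eq_of_draws h1 h2
  unfold gboot
  congr 1
  funext i
  unfold bootResidSample
  rw [h1, h2, h3]

/-- The larger of the two squared `𝓛₂`-errors of the clipped fits to bootstrap sample `j`. -/
noncomputable def fitErr (ρ : Measure ((Fin d → ℝ) × ℝ)) (fstar gstar : (Fin d → ℝ) → ℝ)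
    (ω : Outcome d n (c.B + c.Bt)) (j : Fin (c.B + c.Bt)) : ℝ :=
  max (l2sq ρ fun x => gstar x - clip c.A (c.gboot ω j x))
    (l2sq ρ fun x => fstar x - clip c.A (c.fboot ω j x))

variable [IsProbabilityMeasure ρ]

theorem measurable_fitErr (hf : Measurable fstar) (hg : Measurable gstar)
    (j : Fin (c.B + c.Bt)) : Measurable fun ω => c.fitErr ρ fstar gstar ω j := by
  have h1 := ((hg.comp measurable_snd).sub ((measurable_clip c.A).comp
    (c.measurable_gboot j))).pow_const 2
  have h2 := ((hf.comp measurable_snd).sub ((measurable_clip c.A).comp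
    (c.measurable_fboot j))).pow_const 2
  exact (h1.stronglyMeasurable.integral_prod_right (ν := ρ.fst)).measurable.max
    (h2.stronglyMeasurable.integral_prod_right (ν := ρ.fst)).measurable

theorem measureReal_fitErr_eq (h : Nonempty (Block c.part 1)) (hf : Measurable fstar)
    (hg : Measurable gstar) (ε : ℝ) (j j' : Fin (c.B + c.Bt)) :
    (c.law ρ).real {ω | ε < c.fitErr ρ fstar gstar ω j} =
      (c.law ρ).real {ω | ε < c.fitErr ρ fstar gstar ω j'} := by
  have : IsProbabilityMeasure (uniformOn {i | c.part i = 1}) :=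
    isProbabilityMeasure_uniformOn (Set.toFinite _) (h.elim fun i => ⟨i.1, i.2⟩)
  have hT := measurePreserving_piCongrLeft
    (fun _ : Fin (c.B + c.Bt) => Measure.pi fun _ : Fin n => uniformOn {i | c.part i = 1})
    (Equiv.swap j' j)
  set T := MeasurableEquiv.piCongrLeft (fun _ : Fin (c.B + c.Bt) => Fin n → Fin n)
    (Equiv.swap j' j) with hT_def
  have hTj : ∀ κ, T κ j = κ j' := by
    intro κ
    have := Equiv.piCongrLeft_apply_apply (fun _ : Fin (c.B + c.Bt) => Fin n → Fin n)
      (Equiv.swap j' j) κ j'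
    rwa [Equiv.swap_apply_left] at this
  have hpi : SigmaFinite (Measure.pi fun _ : Fin n => ρ) := Measure.pi.sigmaFinite _
  have hprod := (MeasurePreserving.id (Measure.pi fun _ : Fin n => ρ)).prod
    (hT.prod (MeasurePreserving.id ρ.fst))
  have hmp : MeasurePreserving
      (fun ω : Outcome d n (c.B + c.Bt) => (ω.1, T ω.2.1, ω.2.2)) (c.law ρ) (c.law ρ) :=
    hprod
  have hS : MeasurableSet {ω : Outcome d n (c.B + c.Bt) | ε < c.fitErr ρ fstar gstar ω j} :=
    measurableSet_lt measurable_const (c.measurable_fitErr hf hg j)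
  rw [Measure.real, Measure.real, ← hmp.measure_preimage hS.nullMeasurableSet]
  congr 2
  ext ω
  have h1 : c.fboot (ω.1, T ω.2.1, ω.2.2) j = c.fboot ω j' := c.fboot_eq_of_draws rfl (hTj _)
  have h2 : c.gboot (ω.1, T ω.2.1, ω.2.2) j = c.gboot ω j' := c.gboot_eq_of_draws rfl (hTj _)
  simp only [Set.mem_preimage, Set.mem_ofPred_eq, fitErr, h1, h2]

theorem measureReal_exists_fitErr_le (h : Nonempty (Block c.part 1)) (hf : Measurable fstar)
    (hg : Measurable gstar) (ε : ℝ) :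
    (c.law ρ).real {ω | ∃ j, ε < c.fitErr ρ fstar gstar ω j} ≤
      ((c.B + c.Bt : ℕ) : ℝ) * (c.law ρ).real {ω | ε < c.fitErr ρ fstar gstar ω c.firstCentre} := by
  have := c.isProbabilityMeasure_law ρ h
  have hU : {ω | ∃ j, ε < c.fitErr ρ fstar gstar ω j} =
      ⋃ j, {ω | ε < c.fitErr ρ fstar gstar ω j} := by
    ext ω; simp
  rw [hU]
  refine (measureReal_iUnion_fintype_le _).trans ?_
  simp_rw [fun j => c.measureReal_fitErr_eq (ρ := ρ) h hf hg ε j c.firstCentre]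
  simp

end BootConfig

namespace BootConfig

variable {d n : ℕ} (c : BootConfig d n) {ρ : Measure ((Fin d → ℝ) × ℝ)}
  [IsProbabilityMeasure ρ] {fstar gstar : (Fin d → ℝ) → ℝ}

/-! ### Coverage at a fixed sample size -/

/-- By convexity the centre inherits the `𝓛₂`-error of the individual fits. -/
theorem l2sq_sub_centre_le (hM : IsRegressionModel ρ fstar gstar)
    (hA : ∀ᵐ z ∂ρ, |z.2| ≤ c.A) {ω : Outcome d n (c.B + c.Bt)} {δ : ℝ}
    (hδ : ∀ j, c.fitErr ρ fstar gstar ω j ≤ δ) :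
    Integrable (fun x => (fstar x - c.centre ω x) ^ 2) ρ.fst ∧
      l2sq ρ (fun x => fstar x - c.centre ω x) ≤ δ := by
  have hA0 := level_nonneg hA
  have hBt : (0 : ℝ) < c.Bt := Nat.cast_pos.2 c.Bt_pos
  have hf := hM.measurable_f
  have hmeas : ∀ j, Measurable fun x => fstar x - clip c.A (c.fboot ω j x) := fun j =>
    hf.sub ((measurable_clip c.A).comp ((c.measurable_fboot j).comp measurable_prodMk_left))
  have hfA : ∀ᵐ x ∂ρ.fst, |fstar x| ≤ c.A :=
    (ae_fst_iff (measurableSet_le hf.abs measurable_const)).2 (hM.abs_f_le hA)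
  have hint : ∀ j, Integrable (fun x => (fstar x - clip c.A (c.fboot ω j x)) ^ 2) ρ.fst := by
    intro j
    refine integrable_of_ae_abs_le ((hmeas j).pow_const 2) (R := (c.A + c.A) ^ 2) ?_
    filter_upwards [hfA] with x hx
    rw [abs_pow]
    exact pow_le_pow_left₀ (abs_nonneg _)
      ((abs_sub _ _).trans (add_le_add hx (abs_clip_le hA0 _))) 2
  have hsum : ∀ x, fstar x - c.centre ω x =
      (∑ j : Fin c.Bt, (fstar x - clip c.A (c.fboot ω (Fin.natAdd c.B j) x))) / c.Bt := by
    intro x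
    rw [Finset.sum_sub_distrib, sub_div, centre]
    simp [hBt.ne']
  have hle : ∀ x, (fstar x - c.centre ω x) ^ 2 ≤
      (∑ j : Fin c.Bt, (fstar x - clip c.A (c.fboot ω (Fin.natAdd c.B j) x)) ^ 2) / c.Bt := by
    intro x
    rw [hsum, div_pow, div_le_div_iff₀ (by positivity) hBt]
    have := sq_sum_le_card_mul_sum_sq (s := (Finset.univ : Finset (Fin c.Bt)))
      (f := fun j => fstar x - clip c.A (c.fboot ω (Fin.natAdd c.B j) x))
    simp only [Finset.card_univ, Fintype.card_fin] at this
    nlinarith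
  have hint2 : Integrable (fun x => (∑ j : Fin c.Bt,
      (fstar x - clip c.A (c.fboot ω (Fin.natAdd c.B j) x)) ^ 2) / c.Bt) ρ.fst :=
    (integrable_finsetSum _ fun j _ => hint _).div_const _
  have hm : Measurable fun x => (fstar x - c.centre ω x) ^ 2 := by
    simp_rw [hsum]
    exact ((Finset.measurable_fun_sum _ fun j _ => hmeas _).div_const _).pow_const 2
  have hint3 : Integrable (fun x => (fstar x - c.centre ω x) ^ 2) ρ.fst := by
    refine hint2.mono' hm.aestronglyMeasurable (ae_of_all _ fun x => ?_)
    rw [Real.norm_of_nonneg (sq_nonneg _)]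
    exact hle x
  refine ⟨hint3, (integral_mono hint3 hint2 hle).trans ?_⟩
  rw [integral_div, integral_finsetSum _ fun j _ => hint _, div_le_iff₀ hBt]
  refine (Finset.sum_le_card_nsmul _ _ δ fun j _ => ?_).trans (by simp [mul_comm])
  exact (le_max_right _ _).trans (hδ (Fin.natAdd c.B j))

theorem one_sub_le_measureReal_coverEvent (hM : IsRegressionModel ρ fstar gstar)
    (hA : ∀ᵐ z ∂ρ, |z.2| ≤ c.A) (h1 : Nonempty (Block c.part 1)) {δ A₁ α s : ℝ} (hδ : 0 ≤ δ)
    (hs : 0 < Real.log n ^ s) :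
    1 - ((c.law ρ).real {ω | ∃ j, δ < c.fitErr ρ fstar gstar ω j} +
      δ * (100 * Real.log n ^ s) ^ 2) ≤ (c.law ρ).real (c.coverEvent fstar A₁ α s) := by
  have := c.isProbabilityMeasure_law ρ h1
  set b := 1 / (100 * Real.log n ^ s) with hb
  have hb0 : 0 < b := by positivity
  set Bad := {ω | ∃ j, δ < c.fitErr ρ fstar gstar ω j} with hBad
  have hBadm : MeasurableSet Bad := by
    have : Bad = ⋃ j, {ω | δ < c.fitErr ρ fstar gstar ω j} := by ext ω; simp [hBad]
    rw [this]
    exact MeasurableSet.iUnion fun j =>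
      measurableSet_lt measurable_const (c.measurable_fitErr hM.measurable_f hM.measurable_g j)
  have hcm : Measurable fun ω : Outcome d n (c.B + c.Bt) => c.centre ω ω.2.2 := by
    refine (Finset.measurable_fun_sum _ fun j _ => ?_).div_const _
    exact (measurable_clip c.A).comp ((c.measurable_fboot (Fin.natAdd c.B j)).comp
      (f := fun ω : Outcome d n (c.B + c.Bt) => (ω, ω.2.2)) (by fun_prop))
  have hfm : Measurable fun ω : Outcome d n (c.B + c.Bt) => fstar ω.2.2 :=
    hM.measurable_f.comp (by fun_prop)
  set Far := {ω : Outcome d n (c.B + c.Bt) | b < |fstar ω.2.2 - c.centre ω ω.2.2|} with hFar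
  have hFarm : MeasurableSet Far := measurableSet_lt measurable_const (hfm.sub hcm).abs
  have hS : (c.law ρ).real (Far \ Bad) ≤ δ / b ^ 2 := by
    have hr0 : 0 ≤ δ / b ^ 2 := by positivity
    refine ENNReal.toReal_le_of_le_ofReal hr0
      (c.law_le_of_forall_covariate h1 (hFarm.diff hBadm) fun z κ => ?_)
    by_cases hbad : (z, κ, 0) ∈ Bad
    · have : {x | (z, κ, x) ∈ Far \ Bad} = ∅ :=
        Set.eq_empty_of_forall_notMem fun x hx => hx.2 hbad
      rw [this]; simp
    · have hgood : ∀ j, c.fitErr ρ fstar gstar (z, κ, 0) j ≤ δ := by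
        intro j
        by_contra hj
        exact hbad ⟨j, not_le.1 hj⟩
      obtain ⟨hi, hl⟩ := c.l2sq_sub_centre_le hM hA hgood
      have hmarkov := mul_meas_ge_le_integral_of_nonneg (ae_of_all _ fun x => sq_nonneg _) hi (b ^ 2)
      refine (ENNReal.le_ofReal_iff_toReal_le (measure_ne_top _ _) hr0).2 ?_
      rw [le_div_iff₀ (by positivity), mul_comm]
      refine le_trans ?_ (hmarkov.trans hl)
      refine mul_le_mul_of_nonneg_left (measureReal_mono fun x hx => ?_) (by positivity)
      have hx1 : b < |fstar x - c.centre (z, κ, x) x| := hx.1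
      have hx2 : c.centre (z, κ, x) x = c.centre (z, κ, 0) x := rfl
      rw [hx2] at hx1
      rw [Set.mem_ofPred_eq, ← sq_abs (fstar x - _)]
      exact pow_le_pow_left₀ hb0.le hx1.le 2
  have hcover : Set.univ ⊆ c.coverEvent fstar A₁ α s ∪ (Bad ∪ Far \ Bad) := by
    intro ω _
    by_cases hB : ω ∈ Bad
    · exact Or.inr (Or.inl hB)
    by_cases hF : ω ∈ Far
    · exact Or.inr (Or.inr ⟨hF, hB⟩)
    left
    have hF' : |fstar ω.2.2 - c.centre ω ω.2.2| ≤ b := not_lt.1 hF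
    have hw : b ≤ c.logHalfWidth A₁ α s ω := by
      unfold logHalfWidth halfWidth
      have : 0 ≤ √(c.aQ A₁ α (α / (100 * Real.log n ^ s)) ω / (α * c.Bt)) := Real.sqrt_nonneg _
      linarith
    rw [abs_le] at hF'
    exact ⟨by linarith, by linarith⟩
  have hone : (1 : ℝ) = (c.law ρ).real Set.univ := by simp
  have htot := (measureReal_mono hcover).trans ((measureReal_union_le _ _).trans
    (add_le_add_right (measureReal_union_le (μ := c.law ρ) Bad (Far \ Bad)) _))
  have hδb : δ / b ^ 2 = δ * (100 * Real.log n ^ s) ^ 2 := by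
    rw [hb]; field_simp
  rw [← hone] at htot
  linarith

/-! ### The half-width at a fixed sample size -/

/-- On the event where the fits are accurate and the means over `I₄` are close to their
expectations, both `a₁(α)` and the validation mean of `ĝ` are close to `E g*(X)`. -/
theorem aQ_le (hM : IsRegressionModel ρ fstar gstar) (hA : ∀ᵐ z ∂ρ, |z.2| ≤ c.A)
    {ω : Outcome d n (c.B + c.Bt)} {δ t₁ t₂ α a₀ : ℝ} (hα : 0 < α) (hα1 : α < 1) (ha₀ : 0 ≤ a₀)
    (hδ : ∀ j, c.fitErr ρ fstar gstar ω j ≤ δ)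
    (ht₁ : ∀ j, |c.validErr c.A ω j - ∫ w, (w.2 - clip c.A (c.fboot ω j w.1)) ^ 2 ∂ρ| ≤ t₁)
    (ht₂ : |(∑ i : Block c.part 3, clip c.A (c.gboot ω c.firstCentre (ω.1 i).1)) /
      (Fintype.card (Block c.part 3) : ℝ) - ∫ w, clip c.A (c.gboot ω c.firstCentre w.1) ∂ρ| ≤ t₂) :
    c.aQ c.A α a₀ ω ≤ (δ + √δ) + (t₁ + t₂)
      + (c.A ^ 2 * √(32 * (Real.log (8 / α) + Real.log c.Bt) / n)
        + c.A * √(8 * (Real.log (64 / α) + Real.log c.Bt) / n)) + a₀ := by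
  have hA0 := level_nonneg hA
  have hg := hM.measurable_g
  have hfm : ∀ j, Measurable fun x => clip c.A (c.fboot ω j x) := fun j =>
    (measurable_clip c.A).comp ((c.measurable_fboot j).comp measurable_prodMk_left)
  have hgm : Measurable fun x => clip c.A (c.gboot ω c.firstCentre x) :=
    (measurable_clip c.A).comp ((c.measurable_gboot _).comp measurable_prodMk_left)
  set G := ∫ x, gstar x ∂ρ.fst with hG
  have hv : ∀ j, c.validErr c.A ω j ∈ Set.Icc (G - t₁) (G + δ + t₁) := by
    intro j
    have h1 := hM.integral_sq_sub hA (hfm j) (fun x => abs_clip_le hA0 _)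
    have h2 := abs_le.1 (ht₁ j)
    have h3 : l2sq ρ (fun x => fstar x - clip c.A (c.fboot ω j x)) ≤ δ :=
      (le_max_right _ _).trans (hδ j)
    have h4 := l2sq_nonneg (ρ := ρ) (fun x => fstar x - clip c.A (c.fboot ω j x))
    rw [h1] at h2
    exact ⟨by linarith [h2.1], by linarith [h2.2]⟩
  have hBt : (1 : ℝ) ≤ c.Bt := Nat.one_le_cast.2 c.Bt_pos
  have hq : α / (4 * c.Bt) < 1 := by
    rw [div_lt_one (by linarith)]; linarith
  have hq0 : 0 ≤ α / (4 * (c.Bt : ℝ)) := by positivity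
  have ha1 : c.a1 c.A α ω ∈ Set.Icc (G - t₁) (G + δ + t₁) :=
    empQuantile_mem_Icc (c.Bt_pos.trans c.Bt_lt) (by linarith) (by linarith) fun j => hv _
  have hgR : ∀ᵐ x ∂ρ.fst, |gstar x| ≤ 4 * c.A ^ 2 + c.A := by
    refine (ae_fst_iff (measurableSet_le hg.abs measurable_const)).2 ?_
    filter_upwards [hM.abs_g_le hA] with z hz
    linarith
  have hd := abs_integral_sub_le_sqrt_l2sq hg hgm hgR
    (ae_of_all _ fun x => (abs_clip_le hA0 _).trans (by nlinarith [sq_nonneg c.A]))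
  have hd2 : √(l2sq ρ fun x => gstar x - clip c.A (c.gboot ω c.firstCentre x)) ≤ √δ :=
    Real.sqrt_le_sqrt ((le_max_left _ _).trans (hδ c.firstCentre))
  rw [← integral_fst_eq hgm] at ht₂
  have hd3 := abs_le.1 (hd.trans hd2)
  have ht₂' := abs_le.1 ht₂
  have hδ0 : 0 ≤ δ := (l2sq_nonneg _).trans ((le_max_left _ _).trans (hδ c.firstCentre))
  have hD1 : 0 ≤ c.A ^ 2 * √(32 * (Real.log (8 / α) + Real.log c.Bt) / n) := by positivity
  have hD2 : 0 ≤ c.A * √(8 * (Real.log (64 / α) + Real.log c.Bt) / n) := by positivity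
  unfold aQ
  rw [abs_le]
  constructor
  · linarith [ha1.1]
  · linarith [ha1.2]

/-- With the deviations `4 A² u` and `2 A u`, the bound of `aQ_le` fails with a probability that is
exponentially small in `|I₄| u²`, up to the probability of an inaccurate fit. -/
theorem measureReal_lt_aQ_le (hM : IsRegressionModel ρ fstar gstar)
    (hA : ∀ᵐ z ∂ρ, |z.2| ≤ c.A) (hA0 : 0 < c.A) (h1 : Nonempty (Block c.part 1))
    (h3 : Nonempty (Block c.part 3)) {δ u α a₀ : ℝ} (hα : 0 < α) (hα1 : α < 1) (ha₀ : 0 ≤ a₀)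
    (hu : 0 ≤ u) :
    (c.law ρ).real {ω | (δ + √δ) + (4 * c.A ^ 2 * u + 2 * c.A * u)
      + (c.A ^ 2 * √(32 * (Real.log (8 / α) + Real.log c.Bt) / n)
        + c.A * √(8 * (Real.log (64 / α) + Real.log c.Bt) / n)) + a₀ < c.aQ c.A α a₀ ω} ≤
      (c.law ρ).real {ω | ∃ j, δ < c.fitErr ρ fstar gstar ω j} +
        (((c.B + c.Bt : ℕ) : ℝ) + 1) *
          (2 * Real.exp (-(2 * Fintype.card (Block c.part 3) * u ^ 2))) := by
  have := c.isProbabilityMeasure_law ρ h1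
  set m : ℝ := ((Fintype.card (Block c.part 3) : ℕ) : ℝ) with hm
  set E₁ : Fin (c.B + c.Bt) → Set (Outcome d n (c.B + c.Bt)) := fun j =>
    {ω | 4 * c.A ^ 2 * u ≤ |c.validErr c.A ω j -
      ∫ w, (w.2 - clip c.A (c.fboot ω j w.1)) ^ 2 ∂ρ|} with hE₁
  set E₂ : Set (Outcome d n (c.B + c.Bt)) :=
    {ω | 2 * c.A * u ≤ |(∑ i : Block c.part 3, clip c.A (c.gboot ω c.firstCentre (ω.1 i).1)) / m
      - ∫ w, clip c.A (c.gboot ω c.firstCentre w.1) ∂ρ|} with hE₂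
  have hmf : ∀ j, Measurable fun p : Outcome d n (c.B + c.Bt) × ((Fin d → ℝ) × ℝ) =>
      clip c.A (c.fboot p.1 j p.2.1) := fun j =>
    (measurable_clip c.A).comp ((c.measurable_fboot j).comp
      (f := fun p : Outcome d n (c.B + c.Bt) × ((Fin d → ℝ) × ℝ) => (p.1, p.2.1)) (by fun_prop))
  have hmg : ∀ j, Measurable fun p : Outcome d n (c.B + c.Bt) × ((Fin d → ℝ) × ℝ) =>
      clip c.A (c.gboot p.1 j p.2.1) := fun j =>
    (measurable_clip c.A).comp ((c.measurable_gboot j).comp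
      (f := fun p : Outcome d n (c.B + c.Bt) × ((Fin d → ℝ) × ℝ) => (p.1, p.2.1)) (by fun_prop))
  have hp₁ : ∀ j, (c.law ρ).real (E₁ j) ≤ 2 * Real.exp (-(2 * m * u ^ 2)) := by
    intro j
    have := c.law_abs_validMean_sub_ge_le (ρ := ρ) h1 h3
      (H := fun ω w => (w.2 - clip c.A (c.fboot ω j w.1)) ^ 2)
      (((measurable_snd.comp measurable_snd).sub (hmf j)).pow_const 2)
      (fun z z' κ x hz hκ => by simp only [fboot_congr hz (hκ j)])
      (a := 0) (b := 4 * c.A ^ 2) (t := 4 * c.A ^ 2 * u)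
      (fun ω => by
        filter_upwards [hA] with w hw
        have h2 := abs_le.1 (abs_clip_le hA0.le (c.fboot ω j w.1))
        have h3 := abs_le.1 hw
        exact ⟨sq_nonneg _, by nlinarith⟩) (by positivity)
    refine this.trans (le_of_eq ?_)
    congr 3
    field_simp
    ring
  have hp₂ : (c.law ρ).real E₂ ≤ 2 * Real.exp (-(2 * m * u ^ 2)) := by
    have := c.law_abs_validMean_sub_ge_le (ρ := ρ) h1 h3
      (H := fun ω w => clip c.A (c.gboot ω c.firstCentre w.1)) (hmg _)
      (fun z z' κ x hz hκ => by simp only [gboot_congr hz (hκ c.firstCentre)])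
      (a := -c.A) (b := c.A) (t := 2 * c.A * u)
      (fun ω => ae_of_all _ fun w => abs_le.1 (abs_clip_le hA0.le _)) (by positivity)
    refine this.trans (le_of_eq ?_)
    congr 3
    have : c.A - -c.A = 2 * c.A := by ring
    rw [this, ← hm]
    field_simp
  have hsub : {ω | (δ + √δ) + (4 * c.A ^ 2 * u + 2 * c.A * u)
      + (c.A ^ 2 * √(32 * (Real.log (8 / α) + Real.log c.Bt) / n)
        + c.A * √(8 * (Real.log (64 / α) + Real.log c.Bt) / n)) + a₀ < c.aQ c.A α a₀ ω} ⊆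
      {ω | ∃ j, δ < c.fitErr ρ fstar gstar ω j} ∪ ((⋃ j, E₁ j) ∪ E₂) := by
    intro ω hω
    by_contra hnot
    simp only [Set.mem_union, Set.mem_ofPred_eq, Set.mem_iUnion, not_or, not_exists, not_lt,
      not_le, hE₁, hE₂] at hnot
    exact absurd (c.aQ_le hM hA hα hα1 ha₀ hnot.1 (fun j => (hnot.2.1 j).le) hnot.2.2.le)
      (not_le.2 hω)
  refine (measureReal_mono hsub).trans ((measureReal_union_le _ _).trans ?_)
  refine add_le_add_right ((measureReal_union_le _ _).trans ?_) _
  have hU : (c.law ρ).real (⋃ j, E₁ j) ≤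
      ((c.B + c.Bt : ℕ) : ℝ) * (2 * Real.exp (-(2 * m * u ^ 2))) := by
    refine (measureReal_iUnion_fintype_le _).trans ?_
    refine (Finset.sum_le_card_nsmul _ _ _ fun j _ => hp₁ j).trans (by simp)
  linarith

end BootConfig

/-! ### Asymptotics -/

theorem tendsto_log_natCast_atTop : Tendsto (fun n : ℕ => Real.log n) atTop atTop :=
  Real.tendsto_log_atTop.comp tendsto_natCast_atTop_atTop

/-- A bound with a positive, in fact arbitrarily large, constant extracted from `u = O(v)`. -/
theorem exists_one_le_bound {u v : ℕ → ℝ} (h : u =O[atTop] v) :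
    ∃ K : ℝ, 1 ≤ K ∧ ∀ᶠ n in atTop, |u n| ≤ K * |v n| := by
  obtain ⟨K, hK⟩ := h.bound
  refine ⟨max K 1, le_max_right _ _, hK.mono fun n hn => ?_⟩
  exact hn.trans (mul_le_mul_of_nonneg_right (le_max_left _ _) (norm_nonneg _))

theorem IsPolyLog.exists_pow_bound {u : ℕ → ℝ} (h : IsPolyLog u) :
    ∃ (K : ℝ) (k : ℕ), 1 ≤ K ∧ ∀ᶠ n : ℕ in atTop, |u n| ≤ K * Real.log n ^ k := by
  obtain ⟨p, hp⟩ := h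
  have h1 : (fun x => p.eval x) =O[atTop] fun x => (Polynomial.X ^ p.natDegree :
      Polynomial ℝ).eval x := by
    refine Polynomial.isBigO_atTop_of_degree_le _ _ ?_
    rw [Polynomial.degree_X_pow]
    exact Polynomial.degree_le_natDegree
  obtain ⟨K, hK, hb⟩ := exists_one_le_bound (hp.trans (h1.comp_tendsto tendsto_log_natCast_atTop))
  refine ⟨K, p.natDegree, hK, ?_⟩
  filter_upwards [hb, tendsto_log_natCast_atTop.eventually_ge_atTop 1] with n hn hL
  simpa [abs_of_nonneg (zero_le_one.trans hL)] using hn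

theorem rate_nonneg (P : Finset (ℝ × ℕ)) (hP : P.Nonempty) (n : ℕ) : 0 ≤ rate P hP n := by
  obtain ⟨pK, h⟩ := hP
  exact (Real.rpow_nonneg (Nat.cast_nonneg n) _).trans
    (Finset.le_sup' (fun pK : ℝ × ℕ => (n : ℝ) ^ (-(2 * pK.1) / (2 * pK.1 + pK.2))) h)

/-- The rate is never faster than the parametric one. -/
theorem inv_le_rate {P : Finset (ℝ × ℕ)} (hP : P.Nonempty) (h1 : ∀ pK ∈ P, 1 ≤ pK.1) {n : ℕ}
    (hn : 1 ≤ n) : (n : ℝ)⁻¹ ≤ rate P hP n := by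
  have ⟨pK, h⟩ := hP
  refine le_trans ?_ (Finset.le_sup'
    (fun pK : ℝ × ℕ => (n : ℝ) ^ (-(2 * pK.1) / (2 * pK.1 + pK.2))) h)
  rw [← Real.rpow_neg_one]
  refine Real.rpow_le_rpow_of_exponent_le (Nat.one_le_cast.2 hn) ?_
  have hp := h1 pK h
  have hK : (0 : ℝ) ≤ pK.2 := Nat.cast_nonneg _
  rw [le_div_iff₀ (by linarith)]
  linarith

theorem div_le_lengthRate {φ ψ α : ℝ} (hφ : 0 ≤ φ) (hψ : 0 ≤ ψ) (hα : 0 < α) (hα1 : α < 1)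
    (Bt n : ℕ) : φ ^ (1 / 4 : ℝ) / √(α * Bt) ≤ lengthRate φ ψ α Bt n := by
  have hlog : 0 ≤ Real.log (1 / α) := Real.log_nonneg ((one_le_div hα).2 hα1.le)
  have h1 : √(α * Bt) = (Bt : ℝ) ^ (1 / 2 : ℝ) * α ^ (1 / 2 : ℝ) := by
    rw [mul_comm, Real.sqrt_mul (Nat.cast_nonneg _), Real.sqrt_eq_rpow, Real.sqrt_eq_rpow]
  have h2 : φ ^ (1 / 4 : ℝ) / √(α * Bt) ≤
      (φ ^ (1 / 4 : ℝ) + ψ ^ (1 / 4 : ℝ)) / ((Bt : ℝ) ^ (1 / 2 : ℝ) * α ^ (1 / 2 : ℝ)) := by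
    rw [h1]
    gcongr
    exact le_add_of_nonneg_right (by positivity)
  unfold lengthRate
  have h3 : 0 ≤ Real.log (1 / α) ^ (1 / 4 : ℝ) /
        ((Bt : ℝ) ^ (1 / 2 : ℝ) * α ^ (1 / 2 : ℝ) * (n : ℝ) ^ (1 / 4 : ℝ)) := by positivity
  have h4 : 0 ≤ φ ^ (1 / 2 : ℝ) / α := by positivity
  linarith

/-- The passage from a bound for `a(α)` to a bound for the half-width. The accuracy
`δ = 10⁻⁵ α² / ℓ²` of the fits (with `ℓ = log^s n`) enters `a(α)` through `√δ` and, like `a₀`, is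
absorbed by the term `√(1 / (B̃ ℓ))`. -/
theorem two_mul_sqrt_add_le {a α ℓ D r : ℝ} {Bt : ℕ} (hBt : 0 < Bt) (hα : 0 < α) (hα1 : α < 1)
    (hℓ : 1 ≤ ℓ) (hD : 0 ≤ D) (hDr : 2 * √D ≤ r)
    (ha : a ≤ (1 / 100000 * α ^ 2 / ℓ ^ 2 + √(1 / 100000 * α ^ 2 / ℓ ^ 2)) + D
      + α / (100 * ℓ)) :
    2 * √(a / (α * Bt)) + 1 / (100 * ℓ) ≤ r / √(α * Bt) + (√(1 / (Bt * ℓ)) + 1 / ℓ) := by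
  have hB : (0 : ℝ) < Bt := Nat.cast_pos.2 hBt
  have hℓ0 : 0 < ℓ := by linarith
  set v := α / ℓ with hv
  have hv0 : 0 < v := by positivity
  have hv1 : v ≤ 1 := by rw [hv, div_le_one hℓ0]; linarith
  have e1 : 1 / 100000 * α ^ 2 / ℓ ^ 2 = 1 / 100000 * v ^ 2 := by rw [hv]; field_simp
  have e2 : α / (100 * ℓ) = v / 100 := by rw [hv]; field_simp
  have e3 : √(1 / 100000 * v ^ 2) ≤ 1 / 100 * v := by
    rw [Real.sqrt_le_left (by positivity)]
    nlinarith [sq_nonneg v]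
  rw [e1, e2] at ha
  have ha2 : a ≤ v / 4 + D := by nlinarith
  have hab : a / (α * Bt) ≤ 1 / (Bt * ℓ) / 4 + D / (α * Bt) := by
    have : 1 / (Bt * ℓ) / 4 + D / (α * Bt) = (v / 4 + D) / (α * Bt) := by
      rw [hv]; field_simp
    rw [this]
    gcongr
  have h1 : √(a / (α * Bt)) ≤ √(1 / (Bt * ℓ)) / 2 + √D / √(α * Bt) := by
    have hadd : ∀ {x y : ℝ}, 0 ≤ x → 0 ≤ y → √(x + y) ≤ √x + √y := fun {x y} hx hy => by
      rw [Real.sqrt_le_left (by positivity), add_sq, Real.sq_sqrt hx, Real.sq_sqrt hy]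
      nlinarith [mul_nonneg (Real.sqrt_nonneg x) (Real.sqrt_nonneg y)]
    refine (Real.sqrt_le_sqrt hab).trans ((hadd (by positivity) (by positivity)).trans
      (le_of_eq ?_))
    congr 1
    · rw [Real.sqrt_div (by positivity)]
      congr 1
      rw [show (4 : ℝ) = 2 ^ 2 by norm_num, Real.sqrt_sq (by norm_num)]
    · rw [Real.sqrt_div hD]
  have h2 : 2 * √D / √(α * Bt) ≤ r / √(α * Bt) := by gcongr
  have h3 : 1 / (100 * ℓ) ≤ 1 / ℓ := by
    rw [div_le_div_iff₀ (by positivity) hℓ0]; linarith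
  have h4 : 2 * √D / √(α * Bt) = 2 * (√D / √(α * Bt)) := by ring
  linarith

/-- The deterministic terms of `a(α)` and the fluctuations over `I₄` are of order `n^{-1/2}` up to
logarithms, hence negligible against `φ^{1/2}`. -/
theorem two_mul_sqrt_noise_le {A L M K₃ K₄ η u x₁ x₂ φ : ℝ} {n k : ℕ} (hn : 1 ≤ n) (hA : 0 ≤ A)
    (hL : 1 ≤ L) (hM : 1 ≤ M) (hK₃ : 0 ≤ K₃) (hK₄ : 0 ≤ K₄) (hAM : A ≤ M * L ^ k)
    (hu : u ≤ √(K₃ * L / n)) (hx₁ : x₁ ≤ K₄ * L / n) (hx₂ : x₂ ≤ K₄ * L / n)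
    (hφ : (n : ℝ)⁻¹ ≤ φ)
    (hη : 2 * √(M ^ 2 * (6 * √K₃ + 2 * √K₄)) ≤ η * L) :
    2 * √((4 * A ^ 2 * u + 2 * A * u) + (A ^ 2 * √x₁ + A * √x₂)) ≤
      η * L ^ (2 * k + 2) * φ ^ (1 / 4 : ℝ) := by
  have hn0 : (0 : ℝ) < n := Nat.cast_pos.2 hn
  have hLk : 1 ≤ L ^ k := one_le_pow₀ hL
  have hsq : ∀ K : ℝ, 0 ≤ K → √(K * L / n) ≤ √K * (L * √(n : ℝ)⁻¹) := by
    intro K hK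
    rw [div_eq_mul_inv, Real.sqrt_mul (by positivity), Real.sqrt_mul hK, mul_assoc]
    gcongr
    exact Real.sqrt_le_self_iff.2 (Or.inr hL)
  set w := L * √(n : ℝ)⁻¹ with hw
  have hw0 : 0 ≤ w := by positivity
  have hu' : u ≤ √K₃ * w := hu.trans (hsq _ hK₃)
  have h1 : √x₁ ≤ √K₄ * w := (Real.sqrt_le_sqrt hx₁).trans (hsq _ hK₄)
  have h2 : √x₂ ≤ √K₄ * w := (Real.sqrt_le_sqrt hx₂).trans (hsq _ hK₄)
  set N := M * L ^ k with hN
  have hN1 : 1 ≤ N := one_le_mul_of_one_le_of_one_le hM hLk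
  have hA2 : A ^ 2 ≤ N ^ 2 := pow_le_pow_left₀ hA hAM 2
  have hA1 : A ≤ N ^ 2 := hAM.trans (by nlinarith)
  have hD : (4 * A ^ 2 * u + 2 * A * u) + (A ^ 2 * √x₁ + A * √x₂) ≤
      M ^ 2 * (6 * √K₃ + 2 * √K₄) * (L ^ (2 * k + 1) * √(n : ℝ)⁻¹) := by
    calc (4 * A ^ 2 * u + 2 * A * u) + (A ^ 2 * √x₁ + A * √x₂)
        ≤ (4 * A ^ 2 * (√K₃ * w) + 2 * A * (√K₃ * w)) +
          (A ^ 2 * (√K₄ * w) + A * (√K₄ * w)) := by gcongr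
      _ ≤ (4 * N ^ 2 * (√K₃ * w) + 2 * N ^ 2 * (√K₃ * w)) +
          (N ^ 2 * (√K₄ * w) + N ^ 2 * (√K₄ * w)) := by gcongr
      _ = _ := by rw [hN, hw]; ring
  have hquarter : √(√(n : ℝ)⁻¹) ≤ φ ^ (1 / 4 : ℝ) := by
    rw [Real.sqrt_eq_rpow, Real.sqrt_eq_rpow, ← Real.rpow_mul (by positivity)]
    norm_num only
    exact Real.rpow_le_rpow (by positivity) hφ (by norm_num)
  have hLp : 1 ≤ L ^ (2 * k + 1) := one_le_pow₀ hL
  calc 2 * √((4 * A ^ 2 * u + 2 * A * u) + (A ^ 2 * √x₁ + A * √x₂))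
      ≤ 2 * √(M ^ 2 * (6 * √K₃ + 2 * √K₄) * (L ^ (2 * k + 1) * √(n : ℝ)⁻¹)) := by gcongr
    _ = 2 * √(M ^ 2 * (6 * √K₃ + 2 * √K₄)) * (√(L ^ (2 * k + 1)) * √(√(n : ℝ)⁻¹)) := by
        have hnn : 0 ≤ M ^ 2 * (6 * √K₃ + 2 * √K₄) := by positivity
        rw [Real.sqrt_mul hnn, Real.sqrt_mul (zero_le_one.trans hLp), mul_assoc]
    _ ≤ (η * L) * (L ^ (2 * k + 1) * φ ^ (1 / 4 : ℝ)) := by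
        gcongr
        · exact le_trans (by positivity) hη
        · exact Real.sqrt_le_self_iff.2 (Or.inr hLp)
    _ = _ := by ring

/-- A union bound over `N = O(n^q)` events of probability `o(n^{-(q+1)})` costs `o(1 / n)`, which is
`o(α)`. -/
theorem card_mul_isLittleO {N : ℕ → ℕ} {p α : ℕ → ℝ} {q : ℝ}
    (hN : (fun n => (N n : ℝ)) =O[atTop] fun n : ℕ => (n : ℝ) ^ q)
    (hp : Tendsto (fun n : ℕ => (n : ℝ) ^ (q + 1) * p n) atTop (𝓝 0))
    (hα : (fun n : ℕ => 1 / (n : ℝ)) =O[atTop] α) :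
    (fun n => (N n : ℝ) * p n) =o[atTop] α := by
  have hp' : p =o[atTop] fun n : ℕ => ((n : ℝ) ^ (q + 1))⁻¹ := by
    rw [isLittleO_iff_tendsto']
    · refine hp.congr fun n => ?_
      rw [div_inv_eq_mul, mul_comm]
    · filter_upwards [eventually_ge_atTop 1] with n hn h0
      have : (0 : ℝ) < n := Nat.cast_pos.2 hn
      exact absurd h0 (by positivity)
  refine ((hN.mul_isLittleO hp').congr' EventuallyEq.rfl ?_).trans_isBigO hα
  filter_upwards [eventually_ge_atTop 1] with n hn
  have hn0 : (0 : ℝ) < n := Nat.cast_pos.2 hn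
  rw [Real.rpow_add_one hn0.ne']
  field_simp

/-! ### Coverage and length along a sequence of configurations -/

section Sequences

variable {d : ℕ} {ρ : Measure ((Fin d → ℝ) × ℝ)} [IsProbabilityMeasure ρ]
  {fstar gstar : (Fin d → ℝ) → ℝ} {cfg : ∀ n : ℕ, BootConfig d n} {α ε : ℕ → ℝ} {s q : ℝ}

/-- The number of observations divided by the size of a block is bounded. -/
theorem exists_block_card_bound {k : Fin 4}
    (h : (fun n => (Fintype.card (Block (cfg n).part k) : ℝ))
      =Θ[atTop] fun n : ℕ => (n : ℝ) / 4) :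
    ∃ K : ℝ, 1 ≤ K ∧ ∀ᶠ n : ℕ in atTop,
      (n : ℝ) ≤ K * Fintype.card (Block (cfg n).part k) ∧ Nonempty (Block (cfg n).part k) := by
  obtain ⟨K, hK, hb⟩ := exists_one_le_bound h.2
  refine ⟨4 * K, by linarith, ?_⟩
  filter_upwards [hb, eventually_ge_atTop 1] with n hn hn1
  have hn0 : (0 : ℝ) < n := Nat.cast_pos.2 hn1
  rw [abs_of_nonneg (by positivity), abs_of_nonneg (Nat.cast_nonneg _)] at hn
  have h4 : (n : ℝ) ≤ 4 * K * Fintype.card (Block (cfg n).part k) := by linarith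
  refine ⟨h4, Fintype.card_pos_iff.1 (Nat.pos_of_ne_zero fun h0 => ?_)⟩
  rw [h0] at h4
  simp at h4
  omega

theorem draws_isBigO (hB : (fun n => ((cfg n).B : ℝ)) =O[atTop] fun n : ℕ => (n : ℝ) ^ q) :
    (fun n => (((cfg n).B + (cfg n).Bt : ℕ) : ℝ)) =O[atTop] fun n : ℕ => (n : ℝ) ^ q := by
  refine IsBigO.trans (IsBigO.of_bound 2 (Eventually.of_forall fun n => ?_)) hB
  have : ((cfg n).Bt : ℝ) ≤ (cfg n).B := Nat.cast_le.2 (cfg n).Bt_lt.le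
  rw [Real.norm_of_nonneg (by positivity), Real.norm_of_nonneg (by positivity)]
  push_cast
  linarith

/-- All bootstrap fits are accurate, except with probability `o(α)`. -/
theorem exists_fitErr_isLittleO (hM : IsRegressionModel ρ fstar gstar) {δ : ℕ → ℝ}
    (hα : (fun n : ℕ => 1 / (n : ℝ)) =O[atTop] α)
    (hcard : ∀ k : Fin 4, (fun n => (Fintype.card (Block (cfg n).part k) : ℝ))
      =Θ[atTop] fun n : ℕ => (n : ℝ) / 4)
    (hB : (fun n => ((cfg n).B : ℝ)) =O[atTop] fun n : ℕ => (n : ℝ) ^ q)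
    (hprob : Tendsto (fun n : ℕ => (n : ℝ) ^ (q + 1) * ((cfg n).law ρ).real
      {ω | ε n < (cfg n).fitErr ρ fstar gstar ω (cfg n).firstCentre}) atTop (𝓝 0))
    (hε : ∀ᶠ n in atTop, ε n ≤ δ n) :
    (fun n => ((cfg n).law ρ).real {ω | ∃ j, δ n < (cfg n).fitErr ρ fstar gstar ω j})
      =o[atTop] α := by
  refine IsBigO.trans_isLittleO (IsBigO.of_bound 1 ?_)
    (card_mul_isLittleO (draws_isBigO hB) hprob hα)
  obtain ⟨_, _, hne⟩ := exists_block_card_bound (hcard 1)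
  filter_upwards [hε, hne] with n hn h1
  have := (cfg n).isProbabilityMeasure_law ρ h1.2
  rw [Real.norm_of_nonneg measureReal_nonneg, one_mul]
  refine le_trans ?_ (((cfg n).measureReal_exists_fitErr_le h1.2 hM.measurable_f hM.measurable_g
    (ε n)).trans (le_abs_self _))
  exact measureReal_mono fun ω ⟨j, hj⟩ => ⟨j, hn.trans_lt hj⟩

/-- Coverage holds for every clipping level `A₁` in the half-width, since the half-width is at
least `b(α)`. -/
theorem eventually_coverage (hM : IsRegressionModel ρ fstar gstar)
    (hα01 : ∀ n, 0 < α n ∧ α n < 1)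
    (hα : (fun n : ℕ => 1 / (n : ℝ)) =O[atTop] α)
    (hcard : ∀ k : Fin 4, (fun n => (Fintype.card (Block (cfg n).part k) : ℝ))
      =Θ[atTop] fun n : ℕ => (n : ℝ) / 4)
    (hA : ∀ n, ∀ᵐ z ∂ρ, |z.2| ≤ (cfg n).A)
    (hB : (fun n => ((cfg n).B : ℝ)) =O[atTop] fun n : ℕ => (n : ℝ) ^ q)
    (hprob : Tendsto (fun n : ℕ => (n : ℝ) ^ (q + 1) * ((cfg n).law ρ).real
      {ω | ε n < (cfg n).fitErr ρ fstar gstar ω (cfg n).firstCentre}) atTop (𝓝 0))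
    (hε : ∀ᶠ n : ℕ in atTop, ε n ≤ 1 / 100000 * α n ^ 2 / Real.log n ^ (2 * s)) (A₁ : ℕ → ℝ) :
    ∀ᶠ n in atTop,
      1 - α n ≤ ((cfg n).law ρ).real ((cfg n).coverEvent fstar (A₁ n) (α n) s) := by
  have hbad := (exists_fitErr_isLittleO hM hα hcard hB hprob hε).bound one_half_pos
  obtain ⟨_, _, hne⟩ := exists_block_card_bound (hcard 1)
  filter_upwards [hbad, hne, tendsto_log_natCast_atTop.eventually_ge_atTop 1] with n hn h1 hL
  have hα0 := (hα01 n).1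
  have hα1 := (hα01 n).2
  have hL0 : 0 < Real.log n := by linarith
  have hs0 : 0 < Real.log n ^ s := Real.rpow_pos_of_pos hL0 s
  rw [Real.norm_of_nonneg measureReal_nonneg, Real.norm_of_nonneg hα0.le] at hn
  refine le_trans ?_ ((cfg n).one_sub_le_measureReal_coverEvent hM (hA n) h1.2
    (δ := 1 / 100000 * α n ^ 2 / Real.log n ^ (2 * s)) (by positivity) hs0)
  have h2 : Real.log n ^ (2 * s) = (Real.log n ^ s) ^ 2 := by
    rw [mul_comm, Real.rpow_mul hL0.le, Real.rpow_two]
  have h3 : 1 / 100000 * α n ^ 2 / Real.log n ^ (2 * s) * (100 * Real.log n ^ s) ^ 2 =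
      1 / 10 * α n ^ 2 := by
    rw [h2]; field_simp; norm_num
  rw [h3]
  nlinarith

/-- The logarithms in `a(α)` are of order `log n`. -/
theorem exists_log_bound (hα01 : ∀ n, 0 < α n ∧ α n < 1)
    (hα : (fun n : ℕ => 1 / (n : ℝ)) =O[atTop] α) (hq : 0 < q)
    (hB : (fun n => ((cfg n).B : ℝ)) =O[atTop] fun n : ℕ => (n : ℝ) ^ q) :
    ∃ K : ℝ, 0 ≤ K ∧ ∀ᶠ n : ℕ in atTop,
      Real.log (64 / α n) + Real.log (cfg n).Bt ≤ K * Real.log n := by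
  obtain ⟨K₁, hK₁, h1⟩ := exists_one_le_bound hα
  obtain ⟨K₂, hK₂, h2⟩ := exists_one_le_bound hB
  have hlog1 : 0 ≤ Real.log (64 * K₁) := Real.log_nonneg (by linarith)
  have hlog2 : 0 ≤ Real.log K₂ := Real.log_nonneg hK₂
  refine ⟨Real.log (64 * K₁) + Real.log K₂ + 1 + q, by linarith, ?_⟩
  filter_upwards [h1, h2, eventually_ge_atTop 1,
    tendsto_log_natCast_atTop.eventually_ge_atTop 1] with n h1 h2 hn hL
  have hn0 : (0 : ℝ) < n := Nat.cast_pos.2 hn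
  have hα0 := (hα01 n).1
  have hBt : (0 : ℝ) < (cfg n).Bt := Nat.cast_pos.2 (cfg n).Bt_pos
  rw [abs_of_nonneg (by positivity), abs_of_nonneg hα0.le, div_le_iff₀ hn0] at h1
  rw [abs_of_nonneg (by positivity), abs_of_nonneg (by positivity)] at h2
  have e1 : Real.log (64 / α n) ≤ Real.log (64 * K₁) + Real.log n := by
    rw [← Real.log_mul (by positivity) (by positivity)]
    refine Real.log_le_log (by positivity) ?_
    rw [div_le_iff₀ hα0]
    linarith
  have e2 : Real.log (cfg n).Bt ≤ Real.log K₂ + q * Real.log n := by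
    rw [← Real.log_rpow hn0, ← Real.log_mul (by positivity) (by positivity)]
    refine Real.log_le_log hBt (le_trans ?_ h2)
    exact Nat.cast_le.2 (cfg n).Bt_lt.le
  nlinarith

/-- The half-width is, with probability tending to one, at most `η` times a power of `log n` times
the rate, up to the two terms in `log^{-s} n`. -/
theorem exists_poly_length_bound {P₁ P₂ : Finset (ℝ × ℕ)} (hP₁ : P₁.Nonempty)
    (hP₂ : P₂.Nonempty) (hp₁ : ∀ pK ∈ P₁, 1 ≤ pK.1) (hM : IsRegressionModel ρ fstar gstar)
    (hs : 0 < s) (hq : 0 < q) (hα01 : ∀ n, 0 < α n ∧ α n < 1)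
    (hα : (fun n : ℕ => 1 / (n : ℝ)) =O[atTop] α)
    (hcard : ∀ k : Fin 4, (fun n => (Fintype.card (Block (cfg n).part k) : ℝ))
      =Θ[atTop] fun n : ℕ => (n : ℝ) / 4)
    (hA : ∀ n, ∀ᵐ z ∂ρ, |z.2| ≤ (cfg n).A)
    (hB : (fun n => ((cfg n).B : ℝ)) =O[atTop] fun n : ℕ => (n : ℝ) ^ q)
    (hprob : Tendsto (fun n : ℕ => (n : ℝ) ^ (q + 1) * ((cfg n).law ρ).real
      {ω | ε n < (cfg n).fitErr ρ fstar gstar ω (cfg n).firstCentre}) atTop (𝓝 0))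
    (hε : ∀ᶠ n : ℕ in atTop, ε n ≤ 1 / 100000 * α n ^ 2 / Real.log n ^ (2 * s))
    (hApos : ∀ᶠ n in atTop, 0 < (cfg n).A) (hApoly : IsPolyLog fun n => (cfg n).A) :
    ∃ poly : Polynomial ℝ, ∀ η : ℝ, 0 < η →
      Tendsto (fun n : ℕ => ((cfg n).law ρ).real
        {ω | η * (poly.eval (Real.log n) *
              lengthRate (rate P₁ hP₁ n) (rate P₂ hP₂ n) (α n) (cfg n).Bt n)
            + (√(1 / ((cfg n).Bt * Real.log n ^ s)) + 1 / Real.log n ^ s)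
          < (cfg n).logHalfWidth (cfg n).A (α n) s ω}) atTop (𝓝 0) := by
  obtain ⟨M, k, hM1, hMA⟩ := hApoly.exists_pow_bound
  obtain ⟨K, hK1, hm⟩ := exists_block_card_bound (hcard 3)
  obtain ⟨_, _, hne⟩ := exists_block_card_bound (hcard 1)
  obtain ⟨K', hK'0, hlog⟩ := exists_log_bound hα01 hα hq hB
  set δ : ℕ → ℝ := fun n => 1 / 100000 * α n ^ 2 / Real.log n ^ (2 * s) with hδ
  have hbad := exists_fitErr_isLittleO hM hα hcard hB hprob hε
  -- The fluctuation level `u` makes the exponent in Hoeffding's inequality `(q + 1) log n`.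
  set u : ℕ → ℝ := fun n =>
    √((q + 1) * Real.log n / (2 * Fintype.card (Block (cfg n).part 3))) with hu
  have hbad0 : Tendsto (fun n => ((cfg n).law ρ).real
      {ω | ∃ j, δ n < (cfg n).fitErr ρ fstar gstar ω j}) atTop (𝓝 0) := by
    refine (isLittleO_one_iff ℝ).1 (hbad.trans_isBigO (IsBigO.of_bound 1 ?_))
    refine Eventually.of_forall fun n => ?_
    rw [Real.norm_of_nonneg (hα01 n).1.le]
    simpa using (hα01 n).2.le
  have hexp0 : Tendsto (fun n => ((((cfg n).B + (cfg n).Bt : ℕ) : ℝ) + 1) *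
      (2 * Real.exp (-((q + 1) * Real.log n)))) atTop (𝓝 0) := by
    have h1 : (fun n => (((cfg n).B + (cfg n).Bt : ℕ) : ℝ) + 1) =O[atTop]
        fun n : ℕ => (n : ℝ) ^ q := by
      refine IsBigO.trans (IsBigO.of_bound 2 (Eventually.of_forall fun n => ?_)) (draws_isBigO hB)
      have : (1 : ℝ) ≤ ((cfg n).B + (cfg n).Bt : ℕ) :=
        Nat.one_le_cast.2 (Nat.add_pos_right _ (cfg n).Bt_pos)
      rw [Real.norm_of_nonneg (by positivity), Real.norm_of_nonneg (by positivity)]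
      linarith
    have h2 : (fun n : ℕ => 2 * Real.exp (-((q + 1) * Real.log n))) =O[atTop]
        fun n : ℕ => ((n : ℝ) ^ (q + 1))⁻¹ := by
      refine IsBigO.of_bound 2 ?_
      filter_upwards [eventually_ge_atTop 1] with n hn
      have hn0 : (0 : ℝ) < n := Nat.cast_pos.2 hn
      rw [Real.norm_of_nonneg (by positivity), Real.norm_of_nonneg (by positivity),
        Real.rpow_def_of_pos hn0, ← Real.exp_neg, mul_comm (q + 1)]
    have h3 : (fun n : ℕ => (n : ℝ) ^ q * ((n : ℝ) ^ (q + 1))⁻¹) =ᶠ[atTop]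
        fun n : ℕ => ((n : ℝ))⁻¹ := by
      filter_upwards [eventually_ge_atTop 1] with n hn
      have hn0 : (0 : ℝ) < n := Nat.cast_pos.2 hn
      rw [Real.rpow_add_one hn0.ne']
      field_simp
    exact ((h1.mul h2).congr' EventuallyEq.rfl h3).trans_tendsto tendsto_inv_atTop_nhds_zero_nat
  refine ⟨Polynomial.X ^ (2 * k + 2), fun η hη => ?_⟩
  have hsum := hbad0.add hexp0
  rw [add_zero] at hsum
  refine squeeze_zero' (Eventually.of_forall fun n => measureReal_nonneg) ?_ hsum
  filter_upwards [hMA, hm, hne, hlog, hApos, eventually_ge_atTop 1,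
    tendsto_log_natCast_atTop.eventually_ge_atTop 1,
    tendsto_log_natCast_atTop.eventually_ge_atTop
      (2 * √(M ^ 2 * (6 * √(K * (q + 1)) + 2 * √(32 * K'))) / η)]
    with n hMA hm h1 hlog hApos hn hL hLη
  have hα0 := (hα01 n).1
  have hα1 := (hα01 n).2
  have hn0 : (0 : ℝ) < n := Nat.cast_pos.2 hn
  have hL0 : 0 < Real.log n := by linarith
  have hls : 1 ≤ Real.log n ^ s := Real.one_le_rpow hL hs.le
  have hm0 : (0 : ℝ) < Fintype.card (Block (cfg n).part 3) :=
    Nat.cast_pos.2 (Fintype.card_pos_iff.2 hm.2)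
  have hBt1 : (1 : ℝ) ≤ (cfg n).Bt := Nat.one_le_cast.2 (cfg n).Bt_pos
  have := (cfg n).isProbabilityMeasure_law ρ h1.2
  have hprobn := (cfg n).measureReal_lt_aQ_le hM (hA n) hApos h1.2 hm.2 (δ := δ n) (u := u n)
    (a₀ := α n / (100 * Real.log n ^ s)) hα0 hα1 (by positivity) (Real.sqrt_nonneg _)
  have hexpo : 2 * (Fintype.card (Block (cfg n).part 3) : ℝ) * u n ^ 2 =
      (q + 1) * Real.log n := by
    rw [hu, Real.sq_sqrt (by positivity)]
    field_simp
  rw [hexpo] at hprobn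
  refine le_trans (measureReal_mono fun ω hω => ?_) hprobn
  rw [Set.mem_ofPred_eq] at hω ⊢
  by_contra hle
  rw [not_lt] at hle
  refine absurd ?_ (not_le.2 hω)
  have hδn : δ n = 1 / 100000 * α n ^ 2 / (Real.log n ^ s) ^ 2 := by
    rw [hδ]
    simp only
    rw [mul_comm 2 s, Real.rpow_mul hL0.le, Real.rpow_two]
  rw [hδn, add_assoc (1 / 100000 * α n ^ 2 / (Real.log n ^ s) ^ 2 + _)] at hle
  have hφ := inv_le_rate hP₁ hp₁ hn
  have hlog8 : Real.log (8 / α n) ≤ Real.log (64 / α n) := by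
    refine Real.log_le_log (by positivity) ?_
    gcongr
    norm_num
  have hlog64 : 0 ≤ Real.log (64 / α n) + Real.log (cfg n).Bt := by
    refine add_nonneg (Real.log_nonneg ?_) (Real.log_nonneg hBt1)
    rw [one_le_div hα0]; linarith
  have hr := two_mul_sqrt_noise_le (A := (cfg n).A) (L := Real.log n) (M := M) (K₃ := K * (q + 1))
    (K₄ := 32 * K') (η := η) (u := u n) (k := k)
    (x₁ := 32 * (Real.log (8 / α n) + Real.log (cfg n).Bt) / n)
    (x₂ := 8 * (Real.log (64 / α n) + Real.log (cfg n).Bt) / n) (φ := rate P₁ hP₁ n)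
    hn hApos.le hL hM1 (by positivity) (by positivity) ((le_abs_self _).trans hMA)
    (by
      refine Real.sqrt_le_sqrt ?_
      rw [div_le_div_iff₀ (by positivity) hn0]
      have := mul_le_mul_of_nonneg_left hm.1 (by positivity : 0 ≤ (q + 1) * Real.log n)
      have h0 : 0 ≤ (q + 1) * Real.log n * (K * Fintype.card (Block (cfg n).part 3)) := by
        positivity
      nlinarith)
    (div_le_div_of_nonneg_right (by linarith) hn0.le)
    (div_le_div_of_nonneg_right (by linarith) hn0.le) hφ
    (by rw [div_le_iff₀ hη] at hLη; linarith)
  have hu0 : 0 ≤ u n := Real.sqrt_nonneg _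
  have hmain := two_mul_sqrt_add_le (Bt := (cfg n).Bt) (cfg n).Bt_pos hα0 hα1 hls
    (by positivity) hr hle
  refine hmain.trans (add_le_add_left ?_ _)
  have hlen := div_le_lengthRate (rate_nonneg P₁ hP₁ n) (rate_nonneg P₂ hP₂ n) hα0 hα1
    (cfg n).Bt n
  rw [mul_div_assoc, Polynomial.eval_pow, Polynomial.eval_X, mul_assoc]
  gcongr

end Sequences

end BootCI

theorem mainTheorem7 :
    -- the absolute constant for the smallness of `ε_n`
    ∃ c₀ : ℝ, 0 < c₀ ∧
    ∀ (d : ℕ) (P₁ P₂ : Finset (ℝ × ℕ)) (hP₁ : P₁.Nonempty) (hP₂ : P₂.Nonempty)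
      (l₁ l₂ : ℕ) (C c₂ CLip : ℝ),
      0 < d → 1 ≤ l₁ → 1 ≤ l₂ → 1 ≤ CLip →
      (∀ pK ∈ P₁, 1 ≤ pK.1) → (∀ pK ∈ P₂, 1 ≤ pK.1) →
    -- how large the constants in the network architectures have to be
    ∃ cbar : ℝ, 0 < cbar ∧
    ∀ (ρ : MeasureTheory.Measure ((Fin d → ℝ) × ℝ)) [MeasureTheory.IsProbabilityMeasure ρ]
      (fstar gstar : (Fin d → ℝ) → ℝ) (cfg : ∀ n : ℕ, BootCI.BootConfig d n)
      (α ε : ℕ → ℝ) (s q : ℝ),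
      BootCI.IsRegressionModel ρ fstar gstar →
      0 < s → 0 < q →
      (∀ n, 0 < α n ∧ α n < 1) →
      ((fun n : ℕ => 1 / (n : ℝ)) =O[Filter.atTop] α) →
      (∀ k : Fin 4, (fun n => (Fintype.card (BootCI.Block (cfg n).part k) : ℝ))
        =Θ[Filter.atTop] fun n : ℕ => (n : ℝ) / 4) →
      (∀ n, ∀ᵐ z ∂ρ, |z.2| ≤ (cfg n).A) →
      (∀ᶠ n in Filter.atTop, ∀ᵐ ω ∂((cfg n).law ρ), (cfg n).FitsLeastSquares ω) →
      Filter.Tendsto (fun n => ((cfg n).B : ℝ) * α n ^ 2 / (cfg n).Bt)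
        Filter.atTop Filter.atTop →
      ((fun n => ((cfg n).B : ℝ)) =O[Filter.atTop] fun n : ℕ => (n : ℝ) ^ q) →
      Filter.Tendsto (fun n : ℕ => (n : ℝ) ^ (q + 1) * ((cfg n).law ρ).real
          {ω | ε n < max
            (BootCI.l2sq ρ fun x =>
              gstar x - BootCI.clip (cfg n).A ((cfg n).gboot ω (cfg n).firstCentre x))
            (BootCI.l2sq ρ fun x =>
              fstar x - BootCI.clip (cfg n).A ((cfg n).fboot ω (cfg n).firstCentre x))})
        Filter.atTop (nhds 0) →
      (∀ᶠ n : ℕ in Filter.atTop, ε n ≤ c₀ * α n ^ 2 / Real.log n ^ (2 * s)) →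
      -- coverage
      (∀ᶠ n in Filter.atTop,
        1 - α n ≤ ((cfg n).law ρ).real ((cfg n).coverEvent fstar (cfg n).A (α n) s)) ∧
      -- length
      (∀ (c₃ c₄ c₃' c₄' : ℝ) (calA calB U A' : ℕ → ℝ),
        cbar ≤ c₃ → cbar ≤ c₄ → cbar ≤ c₃' → cbar ≤ c₄' →
        BootCI.IsHierarchical d P₁ C c₂ CLip l₁ fstar →
        BootCI.IsHierarchical d P₂ C c₂ CLip l₂ gstar →
        (∀ᶠ n in Filter.atTop, calA n ≥ 8 * max (BootCI.supNorm fstar + U n)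
          (max (8 * BootCI.supNorm fstar) (8 * √(BootCI.rate P₁ hP₁ n)))) →
        (∀ᶠ n in Filter.atTop, calB n ≥ max (8 * calA n * BootCI.supNorm gstar)
          (max (8 * calA n * √(BootCI.rate P₂ hP₂ n))
            (U n ^ 2 + 9 * U n * calA n / 4 + 65 * calA n ^ 2 / 32))) →
        (∀ᶠ n in Filter.atTop, max (calA n) (calB n) < (cfg n).A) →
        BootCI.IsPolyLog (fun n => (cfg n).A) → BootCI.IsPolyLog A' → BootCI.IsPolyLog U →
        (∀ᶠ n in Filter.atTop, ∀ᵐ ω ∂((cfg n).law ρ), ∀ i, (cfg n).part i = 1 →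
          |(cfg n).stdResid ω.1 i| ≤ A' n) →
        Filter.Tendsto (fun n : ℕ => (n : ℝ) ^ q * ((cfg n).law ρ).real
            {ω | ∃ i, U n < |(ω.1 i).2 - fstar (ω.1 i).1|})
          Filter.atTop (nhds 0) →
        (∀ᶠ n in Filter.atTop,
          BootCI.IsArchitecture c₃ c₄ P₁ hP₁ n (cfg n).L (cfg n).ν ∧
          BootCI.IsArchitecture c₃' c₄' P₂ hP₂ n (cfg n).L' (cfg n).ν' ∧
          (cfg n).Lboot = (cfg n).L ∧ (cfg n).νboot = (cfg n).ν ∧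
          (cfg n).Lboot' = (cfg n).L' ∧ (cfg n).νboot' = (cfg n).ν') →
        ∃ Atil : ℕ → ℝ, BootCI.IsPolyLog Atil ∧
          (∀ᶠ n in Filter.atTop,
            1 - α n ≤ ((cfg n).law ρ).real ((cfg n).coverEvent fstar (Atil n) (α n) s)) ∧
          ∃ poly₃ : Polynomial ℝ, ∀ η : ℝ, 0 < η →
            Filter.Tendsto (fun n : ℕ => ((cfg n).law ρ).real
              {ω | η * (poly₃.eval (Real.log n) *
                    BootCI.lengthRate (BootCI.rate P₁ hP₁ n) (BootCI.rate P₂ hP₂ n)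
                      (α n) (cfg n).Bt n)
                  + (√(1 / ((cfg n).Bt * Real.log n ^ s)) + 1 / Real.log n ^ s)
                < (cfg n).logHalfWidth (Atil n) (α n) s ω})
              Filter.atTop (nhds 0)) := by
  -- Chebyshev's inequality at distance `b(α)` needs `100² c₀ ≤ 1 / 2`, and the absorption of `√ε_n`
  -- in the length needs `√c₀` to be small against `1 / 4`.
  refine ⟨1 / 100000, by norm_num, ?_⟩
  intro d P₁ P₂ hP₁ hP₂ l₁ l₂ C c₂ CLip _ _ _ _ hp₁ _
  -- Any positive constant serves here: the depth and width of the networks enter the bounds only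
  -- through the accuracy `ε_n` of the fits.
  refine ⟨1, one_pos, ?_⟩
  intro ρ _ fstar gstar cfg α ε s q hM hs hq hα01 hα hcard hA _ _ hB hprob hε
  have hcov := BootCI.eventually_coverage hM hα01 hα hcard hA hB hprob hε
  refine ⟨hcov fun n => (cfg n).A, ?_⟩
  intro c₃ c₄ c₃' c₄' calA calB U A' _ _ _ _ _ _ hcalA _ hlevel hpoly _ _ _ _ _
  -- Hoeffding's inequality with deviations proportional to `A_n` needs `A_n > 0`; this follows from
  -- `A_n > 𝒜_n ≥ 64 √φ_n ≥ 0`.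
  have hApos : ∀ᶠ n in atTop, 0 < (cfg n).A := by
    filter_upwards [hcalA, hlevel] with n h1 h2
    have h3 : 0 ≤ 8 * √(BootCI.rate P₁ hP₁ n) := by positivity
    have h4 := (le_max_right (8 * BootCI.supNorm fstar) _).trans
      (le_max_right (BootCI.supNorm fstar + U n) (max (8 * BootCI.supNorm fstar)
        (8 * √(BootCI.rate P₁ hP₁ n))))
    have h5 := le_max_left (calA n) (calB n)
    linarith
  -- `A_n` is itself polylogarithmic and can serve as `Ã_n`.
  exact ⟨fun n => (cfg n).A, hpoly, hcov _, BootCI.exists_poly_length_bound hP₁ hP₂ hp₁ hM hs hq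
    hα01 hα hcard hA hB hprob hε hApos hpoly⟩
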